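/- Let $n\ge 4$ be an even integer, let $u:\mathbb{R}^n\to\mathbb{R}$ be smooth, and let $g=e^{2u}|dx|^2$ be the associated conformal metric on $\mathbb{R}^n$. Let $R_g$ be the scalar curvature of $g$, and let $Q$ be its Q-curvature, that is, the function determined by $$(-\Delta)^{n/2}u=Q\,e^{nu}\quad\text{on }\mathbb{R}^n,$$ where $\Delta$ is the Euclidean Laplacian. Write $|\mathbb{S}^n|$ for the volume of the standard unit sphere $\mathbb{S}^n\subset\mathbb{R}^{n+1}$, and say that a condition holds "near infinity" if it holds outside some compact subset of $\mathbb{R}^n$. Assume that $(\mathbb{R}^n,g)$ is complete and that $g$ has finite total Q-curvature, i.e. $Qe^{nu}\in L^1(\mathbb{R}^n)$. 1. If $R_g\ge 0$ near infinity, then $$0\le\int_{\mathbb{R}^n}Qe^{nu}\,dx\le\frac{(n-1)!\,|\mathbb{S}^n|}{2}.$$ 2. If there are constants $C>0$ and $p\ge 0$ such that $R_g(x)\ge C|x|^{-p}$ near infinity, then $$\frac{(n-1)!\,|\mathbb{S}^n|}{2}\max\Big\{0,1-\frac p2\Big\}\le\int_{\mathbb{R}^n}Qe^{nu}\,dx\le\frac{(n-1)!\,|\mathbb{S}^n|}{2}.$$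 In particular, if there is a constant $C>0$ such that $R_g\ge C$ near infinity, then $$\int_{\mathbb{R}^n}Qe^{nu}\,dx=\frac{(n-1)!\,|\mathbb{S}^n|}{2}.$$ -/

import Mathlib

open MeasureTheory Set Filter Topology
open scoped ContDiff Manifold ENNReal

noncomputable section

namespace ConformalQ

/-! ### Riemannian metrics on `ℝⁿ` in the standard global chart

A metric is given by its matrix `(g_ij(x))` in the standard coordinates. -/

/-- The partial derivative `∂_i f` in the standard coordinates of `ℝⁿ`. -/
def partialDeriv {n : ℕ} (i : Fin n) (f : EuclideanSpace ℝ (Fin n) → ℝ)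
    (x : EuclideanSpace ℝ (Fin n)) : ℝ :=
  fderiv ℝ f x (EuclideanSpace.single i 1)

/-- Christoffel symbols of the Levi-Civita connection,
`Γ^k_ij = (1/2) ∑_l g^{kl} (∂_i g_jl + ∂_j g_il - ∂_l g_ij)`. -/
def christoffel {n : ℕ} (g : EuclideanSpace ℝ (Fin n) → Matrix (Fin n) (Fin n) ℝ)
    (k i j : Fin n) (x : EuclideanSpace ℝ (Fin n)) : ℝ :=
  (1 / 2) * ∑ l, (g x)⁻¹ k l *
    (partialDeriv i (fun y => g y j l) x + partialDeriv j (fun y => g y i l) x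
      - partialDeriv l (fun y => g y i j) x)

/-- Ricci curvature,
`Ric_ij = ∑_k (∂_k Γ^k_ij - ∂_j Γ^k_ik) + ∑_{k,l} (Γ^k_kl Γ^l_ij - Γ^k_jl Γ^l_ik)`. -/
def ricci {n : ℕ} (g : EuclideanSpace ℝ (Fin n) → Matrix (Fin n) (Fin n) ℝ)
    (i j : Fin n) (x : EuclideanSpace ℝ (Fin n)) : ℝ :=
  ∑ k, (partialDeriv k (christoffel g k i j) x - partialDeriv j (christoffel g k i k) x)
    + ∑ k, ∑ l, (christoffel g k k l x * christoffel g l i j x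
        - christoffel g k j l x * christoffel g l i k x)

/-- Scalar curvature, `R_g = ∑_{i,j} g^{ij} Ric_ij`. -/
def scalarCurvature {n : ℕ} (g : EuclideanSpace ℝ (Fin n) → Matrix (Fin n) (Fin n) ℝ)
    (x : EuclideanSpace ℝ (Fin n)) : ℝ :=
  ∑ i, ∑ j, (g x)⁻¹ i j * ricci g i j x

/-- The length `√(∑_{i,j} g_ij(x) v_i v_j)` of a tangent vector `v` at `x`. -/
def tangentNorm {n : ℕ} (g : EuclideanSpace ℝ (Fin n) → Matrix (Fin n) (Fin n) ℝ)
    (x v : EuclideanSpace ℝ (Fin n)) : ℝ :=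
  Real.sqrt (∑ i, ∑ j, g x i j * v i * v j)

/-- The Riemannian distance of `g`: the infimum of the `g`-lengths of the `C^1` paths between two
points. -/
def riemannianDist {n : ℕ} (g : EuclideanSpace ℝ (Fin n) → Matrix (Fin n) (Fin n) ℝ)
    (x y : EuclideanSpace ℝ (Fin n)) : ℝ≥0∞ :=
  letI : ∀ p : EuclideanSpace ℝ (Fin n), ENorm (TangentSpace 𝓘(ℝ, EuclideanSpace ℝ (Fin n)) p) :=
    fun p => ⟨fun v => ENNReal.ofReal (tangentNorm g p v)⟩
  Manifold.riemannianEDist 𝓘(ℝ, EuclideanSpace ℝ (Fin n)) x y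

/-- `(ℝⁿ, g)` is complete: every sequence that is Cauchy for the Riemannian distance converges
for it. -/
def IsCompleteMetric {n : ℕ} (g : EuclideanSpace ℝ (Fin n) → Matrix (Fin n) (Fin n) ℝ) : Prop :=
  ∀ s : ℕ → EuclideanSpace ℝ (Fin n),
    (∀ ε : ℝ≥0∞, 0 < ε → ∃ N : ℕ, ∀ k ≥ N, ∀ m ≥ N, riemannianDist g (s k) (s m) < ε) →
    ∃ x, Tendsto (fun k => riemannianDist g (s k) x) atTop (𝓝 0)

/-! ### Conformal metrics and their Q-curvature -/

/-- The conformal metric `e^{2u} |dx|²`. -/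
def conformalMetric {n : ℕ} (u : EuclideanSpace ℝ (Fin n) → ℝ) (x : EuclideanSpace ℝ (Fin n)) :
    Matrix (Fin n) (Fin n) ℝ :=
  Real.exp (2 * u x) • (1 : Matrix (Fin n) (Fin n) ℝ)

/-- The `k`-th power `(-Δ)^k` of the operator `-Δ`, where `Δ = ∑_i ∂_i²` on `ℝⁿ`. -/
def negLaplacianPow {n : ℕ} (k : ℕ) (u : EuclideanSpace ℝ (Fin n) → ℝ) :
    EuclideanSpace ℝ (Fin n) → ℝ :=
  (fun (f : EuclideanSpace ℝ (Fin n) → ℝ) x => -(Laplacian.laplacian f x))^[k] u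

/-- The Q-curvature of `e^{2u} |dx|²` on `ℝⁿ`, `n` even: the function `Q` with
`(-Δ)^{n/2} u = Q e^{nu}`. -/
def qCurvature {n : ℕ} (u : EuclideanSpace ℝ (Fin n) → ℝ) (x : EuclideanSpace ℝ (Fin n)) : ℝ :=
  Real.exp (-(n * u x)) * negLaplacianPow (n / 2) u x

/-- `|𝕊ⁿ|`, the volume of the unit sphere of `ℝⁿ⁺¹`. -/
def sphereVolume (n : ℕ) : ℝ :=
  (volume : Measure (EuclideanSpace ℝ (Fin (n + 1)))).toSphere.real univ

end ConformalQ

end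

/-!
Let `v r` be the mean of `u` over the sphere of radius `r`. Taking means turns the Laplacian into
its radial part `r ^ (1 - n) * (r ^ (n - 1) * v')'`. Nonnegativity of the scalar curvature means
`Δ u + (n - 2) / 2 * |∇ u| ^ 2 ≤ 0`, so by Jensen `v` satisfies a radial Riccati inequality, which
keeps `r * v' r` bounded and asymptotically nonpositive. Together with the finiteness of the total
Q-curvature this excludes the homogeneous solutions of the radial polyharmonic equation, and
`r * v' r` tends to `-α`, where `α` is the total Q-curvature divided by `(n - 1)! |𝕊ⁿ| / 2`. In
particular `0 ≤ α`.

If the scalar curvature is at least `C * |x| ^ (-p)` and `α < 1 - p / 2`, then `exp (2 * v r)`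
decays so slowly that the radial Laplacian of `v` drives `r * v' r` to `-∞`, a contradiction.

If `1 < α`, then the mean value inequality for `exp ((n - 2) / 2 * u)`, which is superharmonic near
infinity, bounds the integral of `exp u` over a dyadic annulus of radius `r` by a multiple of
`r ^ (n - β)` for some `β > 1`. Hence `exp u / |x| ^ (n - 1)` is integrable near infinity, some ray
has finite length, and the metric is not complete.
-/

noncomputable section

namespace ConformalQ

section InfinitesimalRotation

variable {E F ι : Type*} [NormedAddCommGroup E] [InnerProductSpace ℝ E]
  [NormedAddCommGroup F] [NormedSpace ℝ F] [Fintype ι]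

/-- The infinitesimal rotation in the plane of `a` and `b`. -/
def infinitesimalRotation (a b : E) : E →L[ℝ] E :=
  (innerSL ℝ b).smulRight a - (innerSL ℝ a).smulRight b

theorem infinitesimalRotation_apply (a b x : E) :
    infinitesimalRotation a b x = inner ℝ b x • a - inner ℝ a x • b := by
  simp [infinitesimalRotation]

theorem infinitesimalRotation_mem_skewAdjoint [CompleteSpace E] (a b : E) :
    infinitesimalRotation a b ∈ skewAdjoint (E →L[ℝ] E) := by
  rw [skewAdjoint.mem_iff, ContinuousLinearMap.star_eq_adjoint]
  refine ((ContinuousLinearMap.eq_adjoint_iff _ _).2 fun x y => ?_).symm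
  simp only [neg_apply, infinitesimalRotation_apply, inner_neg_left, inner_sub_left,
    inner_sub_right, real_inner_smul_right, real_inner_comm]
  ring

theorem sum_infinitesimalRotation_sq (b : OrthonormalBasis ι ℝ E) (x : E) :
    ∑ i, ∑ j, infinitesimalRotation (b i) (b j) (infinitesimalRotation (b i) (b j) x)
      = -(2 * (Fintype.card ι - 1 : ℝ)) • x := by
  classical
  have expand (i j : ι) : infinitesimalRotation (b i) (b j) (infinitesimalRotation (b i) (b j) x)
      = (if j = i then inner ℝ (b j) x • b i else 0) - inner ℝ (b i) x • b i
        - inner ℝ (b j) x • b j + if i = j then inner ℝ (b i) x • b j else 0 := by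
    simp only [infinitesimalRotation_apply, inner_sub_right, real_inner_smul_right, b.inner_eq_ite,
      if_true]
    split_ifs <;> module
  simp only [expand, Finset.sum_add_distrib, Finset.sum_sub_distrib, Finset.sum_ite_eq,
    Finset.sum_ite_eq', Finset.mem_univ, if_true, Finset.sum_const, ← Finset.smul_sum, b.sum_repr',
    Finset.card_univ, ← Nat.cast_smul_eq_nsmul ℝ]
  module

theorem sum_bilin_infinitesimalRotation (b : OrthonormalBasis ι ℝ E) (B : E →L[ℝ] E →L[ℝ] F)
    (x : E) :
    ∑ i, ∑ j, B (infinitesimalRotation (b i) (b j) x) (infinitesimalRotation (b i) (b j) x)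
      = (2 : ℝ) • (‖x‖ ^ 2 • ∑ i, B (b i) (b i) - B x x) := by
  have expand (i j : ι) :
      B (infinitesimalRotation (b i) (b j) x) (infinitesimalRotation (b i) (b j) x)
      = inner ℝ (b j) x ^ 2 • B (b i) (b i) + inner ℝ (b i) x ^ 2 • B (b j) (b j)
        - (B (inner ℝ (b i) x • b i) (inner ℝ (b j) x • b j)
          + B (inner ℝ (b j) x • b j) (inner ℝ (b i) x • b i)) := by
    simp only [infinitesimalRotation_apply, map_sub, map_smul, sub_apply, smul_apply]
    module
  simp only [expand, Finset.sum_add_distrib, Finset.sum_sub_distrib, ← Finset.smul_sum,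
    ← Finset.sum_smul, ← map_sum, ← sum_apply, b.sum_repr',
    b.sum_sq_inner_right]
  module

theorem laplacian_eq_sum_fderiv_fderiv [FiniteDimensional ℝ E] (b : OrthonormalBasis ι ℝ E)
    (f : E → F) (x : E) :
    Laplacian.laplacian f x = ∑ i, fderiv ℝ (fderiv ℝ f) x (b i) (b i) := by
  simp [InnerProductSpace.laplacian_eq_iteratedFDeriv_orthonormalBasis f b,
    iteratedFDeriv_two_apply]

end InfinitesimalRotation

/-! ### Spherical means -/

section SphericalMean

theorem hasDerivAt_integral_of_continuous {X F : Type*} [TopologicalSpace X] [CompactSpace X]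
    [MeasurableSpace X] [OpensMeasurableSpace X] [NormedAddCommGroup F] [NormedSpace ℝ F]
    {μ : Measure X} [IsFiniteMeasure μ] {K K' : ℝ → X → F} (hK : ∀ t, Continuous (K t))
    (hK' : Continuous K'.uncurry) (hd : ∀ t x, HasDerivAt (K · x) (K' t x) t) (t : ℝ) :
    HasDerivAt (fun τ => ∫ x, K τ x ∂μ) (∫ x, K' t x ∂μ) t := by
  obtain ⟨C, hC⟩ : ∃ C, ∀ p ∈ Icc (t - 1) (t + 1) ×ˢ (univ : Set X), ‖K'.uncurry p‖ ≤ C :=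
    (isCompact_Icc.prod isCompact_univ).exists_bound_of_continuousOn hK'.continuousOn
  have integrable {g : X → F} (hg : Continuous g) : Integrable g μ :=
    hg.integrable_of_hasCompactSupport (.of_compactSpace g)
  exact (hasDerivAt_integral_of_dominated_loc_of_deriv_le (s := Icc (t - 1) (t + 1))
    (bound := fun _ => C) (Icc_mem_nhds (by linarith) (by linarith))
    (.of_forall fun τ => (integrable (hK τ)).aestronglyMeasurable) (integrable (hK t))
    (integrable (hK'.uncurry_left t)).aestronglyMeasurable
    (.of_forall fun x τ hτ => hC (τ, x) ⟨hτ, mem_univ _⟩) (integrable_const C)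
    (.of_forall fun x τ _ => hd τ x)).2

variable {E F : Type*} [NormedAddCommGroup E] [InnerProductSpace ℝ E]
  [NormedAddCommGroup F]

/-- The homeomorphism of the unit sphere induced by a linear isometry. -/
def sphereHomeomorph (A : E ≃ₗᵢ[ℝ] E) :
    Metric.sphere (0 : E) 1 ≃ₜ Metric.sphere (0 : E) 1 :=
  A.toHomeomorph.subtype fun x => by simp

@[simp]
theorem coe_sphereHomeomorph (A : E ≃ₗᵢ[ℝ] E) (s : Metric.sphere (0 : E) 1) :
    (sphereHomeomorph A s : E) = A s := rfl

variable [MeasurableSpace E] [BorelSpace E]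

variable (E) in
/-- The rotation invariant probability measure on the unit sphere. -/
def uniformSphere [FiniteDimensional ℝ E] : Measure (Metric.sphere (0 : E) 1) :=
  ((volume : Measure E).toSphere univ)⁻¹ • (volume : Measure E).toSphere

variable [FiniteDimensional ℝ E]

instance [Nontrivial E] : IsProbabilityMeasure (uniformSphere E) :=
  haveI : NeZero (volume : Measure E).toSphere := ⟨Measure.toSphere_ne_zero _⟩
  isProbabilityMeasureSMul

instance : IsFiniteMeasure (uniformSphere E) := by
  rcases subsingleton_or_nontrivial E with h | h
  · rw [uniformSphere, (Measure.toSphere_eq_zero_iff volume).2 h, smul_zero]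
    infer_instance
  · infer_instance

theorem integrable_uniformSphere {g : Metric.sphere (0 : E) 1 → F} (hg : Continuous g) :
    Integrable g (uniformSphere E) :=
  hg.integrable_of_hasCompactSupport (.of_compactSpace g)

open scoped Pointwise in
theorem measurePreserving_sphereHomeomorph (A : E ≃ₗᵢ[ℝ] E) :
    MeasurePreserving (sphereHomeomorph A) (uniformSphere E) (uniformSphere E) := by
  refine MeasurePreserving.smul_measure ⟨(sphereHomeomorph A).measurable, ?_⟩ _
  ext s hs
  have cone_preimage : A ⁻¹' (Ioo (0 : ℝ) 1 • (Subtype.val '' s))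
      = Ioo (0 : ℝ) 1 • (Subtype.val '' (sphereHomeomorph A ⁻¹' s)) := by
    ext x
    simp only [mem_preimage, Set.mem_smul, mem_image]
    constructor
    · rintro ⟨r, hr, _, ⟨y, hy, rfl⟩, hx⟩
      exact ⟨r, hr, _, ⟨(sphereHomeomorph A).symm y, by simpa using hy, rfl⟩,
        A.injective (by rw [map_smul, ← hx]; exact congrArg _ (A.apply_symm_apply y))⟩
    · rintro ⟨r, hr, _, ⟨y, hy, rfl⟩, rfl⟩
      exact ⟨r, hr, _, ⟨sphereHomeomorph A y, hy, rfl⟩, by simp⟩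
  rw [Measure.map_apply (sphereHomeomorph A).measurable hs, Measure.toSphere_apply' _ hs,
    Measure.toSphere_apply' _ ((sphereHomeomorph A).measurable hs), ← cone_preimage]
  exact congrArg _ (A.measurePreserving.measure_preimage_equiv (f := A.toMeasurableEquiv) _)

variable [NormedSpace ℝ F]

/-- The mean of `f` over the sphere of centre `c` and radius `r`, as a function of `r ∈ ℝ`. -/
def sphericalMean (f : E → F) (c : E) (r : ℝ) : F :=
  ∫ s, f (c + r • (s : E)) ∂uniformSphere E

theorem continuous_sphericalMean {f : E → F} (hf : Continuous f) (c : E) :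
    Continuous (sphericalMean f c) := by
  unfold sphericalMean
  have := continuous_parametric_integral_of_continuous (μ := uniformSphere E)
    (f := fun (r : ℝ) (s : Metric.sphere (0 : E) 1) => f (c + r • (s : E)))
    (by unfold Function.uncurry; fun_prop) isCompact_univ
  simpa only [setIntegral_univ] using this

theorem sphericalMean_zero_right [CompleteSpace F] [Nontrivial E] (f : E → F) (c : E) :
    sphericalMean f c 0 = f c := by
  simp [sphericalMean]

theorem sphericalMean_mono {f g : E → ℝ} (hf : Continuous f) (hg : Continuous g) {c : E} {r : ℝ}
    (h : ∀ s : E, ‖s‖ = 1 → f (c + r • s) ≤ g (c + r • s)) :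
    sphericalMean f c r ≤ sphericalMean g c r :=
  integral_mono (integrable_uniformSphere (by fun_prop)) (integrable_uniformSphere (by fun_prop))
    fun s => h s (by simp)

theorem hasDerivAt_sphericalMean {f : E → F} (hf : ContDiff ℝ 1 f) (c : E) (r : ℝ) :
    HasDerivAt (sphericalMean f c)
      (∫ s : Metric.sphere (0 : E) 1, fderiv ℝ f (c + r • (s : E)) s ∂uniformSphere E) r := by
  have := hf.continuous_fderiv one_ne_zero
  have hc := hf.continuous
  refine hasDerivAt_integral_of_continuous
    (K' := fun t (s : Metric.sphere (0 : E) 1) => fderiv ℝ f (c + t • (s : E)) s)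
    (fun t => by fun_prop)
    (by unfold Function.uncurry; fun_prop) (fun t s => ?_) r
  have hline : HasDerivAt (fun t : ℝ => c + t • (s : E)) s t := by
    simpa using ((hasDerivAt_id t).smul_const (s : E)).const_add c
  exact (hf.differentiable one_ne_zero _).hasFDerivAt.comp_hasDerivAt t hline

theorem hasDerivAt_deriv_sphericalMean {f : E → F} (hf : ContDiff ℝ 2 f) (c : E) (r : ℝ) :
    HasDerivAt (deriv (sphericalMean f c))
      (∫ s : Metric.sphere (0 : E) 1, fderiv ℝ (fderiv ℝ f) (c + r • (s : E)) s s
        ∂uniformSphere E) r := by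
  have hf1 : ContDiff ℝ 1 (fderiv ℝ f) := hf.fderiv_right (by norm_num)
  have hf' := hf1.continuous
  have := hf1.continuous_fderiv one_ne_zero
  rw [funext fun t => (hasDerivAt_sphericalMean (hf.of_le one_le_two) c t).deriv]
  refine hasDerivAt_integral_of_continuous
    (K' := fun t (s : Metric.sphere (0 : E) 1) => fderiv ℝ (fderiv ℝ f) (c + t • (s : E)) s s)
    (fun t => by fun_prop)
    (by unfold Function.uncurry; fun_prop) (fun t s => ?_) r
  have hline : HasDerivAt (fun t : ℝ => c + t • (s : E)) s t := by
    simpa using ((hasDerivAt_id t).smul_const (s : E)).const_add c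
  have hderiv := (hf1.differentiable one_ne_zero _).hasFDerivAt.comp_hasDerivAt t hline
  simpa using hderiv.clm_apply (hasDerivAt_const t (s : E))

theorem integral_sphereHomeomorph (A : E ≃ₗᵢ[ℝ] E) (g : Metric.sphere (0 : E) 1 → F) :
    ∫ s, g (sphereHomeomorph A s) ∂uniformSphere E = ∫ s, g s ∂uniformSphere E :=
  (measurePreserving_sphereHomeomorph A).integral_comp
    (sphereHomeomorph A).measurableEmbedding g

theorem integral_fderiv_skewAdjoint {A : E →L[ℝ] E} (hA : A ∈ skewAdjoint (E →L[ℝ] E))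
    {p : E → F} (hp : ContDiff ℝ 1 p) :
    ∫ s : Metric.sphere (0 : E) 1, fderiv ℝ p s (A s) ∂uniformSphere E = 0 := by
  let : NormedAlgebra ℚ (E →L[ℝ] E) := .restrictScalars ℚ ℝ _
  have := hp.continuous_fderiv one_ne_zero
  have hc := hp.continuous
  have : Continuous fun t : ℝ => NormedSpace.exp (t • A) :=
    (differentiable_exp_smul_const ℝ A).continuous
  have hflow (x : E) (t : ℝ) :
      HasDerivAt (fun τ : ℝ => NormedSpace.exp (τ • A) x) (NormedSpace.exp (t • A) (A x)) t := by
    simpa using (hasDerivAt_exp_smul_const A t).clm_apply (hasDerivAt_const t x)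
  have hderiv := hasDerivAt_integral_of_continuous (μ := uniformSphere E)
    (K := fun t (s : Metric.sphere (0 : E) 1) => p (NormedSpace.exp (t • A) s))
    (K' := fun t s => fderiv ℝ p (NormedSpace.exp (t • A) s) (NormedSpace.exp (t • A) (A s)))
    (fun t => by fun_prop) (by unfold Function.uncurry; fun_prop)
    (fun t s => (hp.differentiable one_ne_zero _).hasFDerivAt.comp_hasDerivAt t (hflow s t)) 0
  -- `exp (t A)` is a rotation, so the integral does not depend on `t`.
  have hconst (t : ℝ) : ∫ s : Metric.sphere (0 : E) 1, p (NormedSpace.exp (t • A) s)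
      ∂uniformSphere E = ∫ s : Metric.sphere (0 : E) 1, p s ∂uniformSphere E :=
    integral_sphereHomeomorph (Unitary.linearIsometryEquiv ⟨NormedSpace.exp (t • A),
      NormedSpace.exp_mem_unitary_of_mem_skewAdjoint (skewAdjoint.smul_mem t hA)⟩) (p ·)
  simpa using (hderiv.congr_of_eventuallyEq
    (.of_forall fun t => (hconst t).symm)).unique (hasDerivAt_const _ _)

theorem integral_fderiv_fderiv_skewAdjoint {A : E →L[ℝ] E} (hA : A ∈ skewAdjoint (E →L[ℝ] E))
    {f : E → F} (hf : ContDiff ℝ 2 f) (c : E) (r : ℝ) :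
    ∫ s : Metric.sphere (0 : E) 1, (r • fderiv ℝ (fderiv ℝ f) (c + r • (s : E)) (A s) (A s)
      + fderiv ℝ f (c + r • (s : E)) (A (A s))) ∂uniformSphere E = 0 := by
  have hf1 : ContDiff ℝ 1 (fderiv ℝ f) := hf.fderiv_right (by norm_num)
  have hshift (x : E) : HasFDerivAt (fun y => c + r • y) (r • ContinuousLinearMap.id ℝ E) x :=
    ((hasFDerivAt_id x).const_smul r).const_add c
  have hderiv (x : E) : HasFDerivAt (fun y => fderiv ℝ f (c + r • y) (A y)) _ x :=
    ((hf1.differentiable one_ne_zero _).hasFDerivAt.comp x (hshift x)).clm_apply A.hasFDerivAt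
  rw [← integral_fderiv_skewAdjoint hA (p := fun x => fderiv ℝ f (c + r • x) (A x)) (by fun_prop)]
  refine integral_congr_ae (.of_forall fun s => ?_)
  simp [(hderiv s).fderiv, add_comm]

/-- Sum `integral_fderiv_fderiv_skewAdjoint` over the rotations of all coordinate planes. -/
theorem smul_sphericalMean_laplacian {f : E → F} (hf : ContDiff ℝ 2 f) (c : E) (r : ℝ) :
    r • sphericalMean (Laplacian.laplacian f) c r
      = r • deriv (deriv (sphericalMean f c)) r
        + (Module.finrank ℝ E - 1 : ℝ) • deriv (sphericalMean f c) r := by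
  let b := stdOrthonormalBasis ℝ E
  have hf1 : ContDiff ℝ 1 (fderiv ℝ f) := hf.fderiv_right (by norm_num)
  have hf' := hf1.continuous
  have := hf1.continuous_fderiv one_ne_zero
  have hsum (s : Metric.sphere (0 : E) 1) :
      r • Laplacian.laplacian f (c + r • (s : E))
        - (r • fderiv ℝ (fderiv ℝ f) (c + r • (s : E)) s s
          + (Module.finrank ℝ E - 1 : ℝ) • fderiv ℝ f (c + r • (s : E)) s)
      = (1 / 2 : ℝ) • ∑ i, ∑ j,
        (r • fderiv ℝ (fderiv ℝ f) (c + r • (s : E)) (infinitesimalRotation (b i) (b j) s)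
            (infinitesimalRotation (b i) (b j) s)
          + fderiv ℝ f (c + r • (s : E))
            (infinitesimalRotation (b i) (b j) (infinitesimalRotation (b i) (b j) s))) := by
    simp only [Finset.sum_add_distrib, ← Finset.smul_sum, ← map_sum, sum_infinitesimalRotation_sq,
      sum_bilin_infinitesimalRotation, ← laplacian_eq_sum_fderiv_fderiv, norm_eq_of_mem_sphere,
      map_smul, Fintype.card_fin]
    module
  have hLaplacian : Continuous (Laplacian.laplacian f) := by
    simp only [funext (laplacian_eq_sum_fderiv_fderiv b f)]
    fun_prop
  rw [sphericalMean, (hasDerivAt_deriv_sphericalMean hf c r).deriv,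
    (hasDerivAt_sphericalMean (hf.of_le one_le_two) c r).deriv, ← sub_eq_zero, ← integral_smul,
    ← integral_smul, ← integral_smul, ← integral_add, ← integral_sub,
    integral_congr_ae (.of_forall hsum), integral_smul, integral_finsetSum]
  · refine smul_eq_zero_of_right _ (Finset.sum_eq_zero fun i _ => ?_)
    rw [integral_finsetSum]
    · exact Finset.sum_eq_zero fun j _ => integral_fderiv_fderiv_skewAdjoint
        (infinitesimalRotation_mem_skewAdjoint (b i) (b j)) hf c r
    · exact fun j _ => integrable_uniformSphere (by fun_prop)
  all_goals intros; exact integrable_uniformSphere (by fun_prop)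

end SphericalMean

/-! ### Radial functions -/

/-- The function `x ↦ v ‖x‖` on an `n`-dimensional Euclidean space has Laplacian `x ↦ L ‖x‖`, in
the divergence form `(rⁿ⁻¹ v')' = rⁿ⁻¹ L`. -/
structure HasRadialLaplacian (n : ℕ) (v L : ℝ → ℝ) : Prop where
  differentiable : Differentiable ℝ v
  hasDerivAt_flux (r : ℝ) :
    HasDerivAt (fun t => t ^ (n - 1) * deriv v t) (r ^ (n - 1) * L r) r

theorem hasRadialLaplacian_sphericalMean {E : Type*} [NormedAddCommGroup E]
    [InnerProductSpace ℝ E] [FiniteDimensional ℝ E] [MeasurableSpace E] [BorelSpace E]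
    (hn : 2 ≤ Module.finrank ℝ E) {f : E → ℝ} (hf : ContDiff ℝ 2 f) (c : E) :
    HasRadialLaplacian (Module.finrank ℝ E) (sphericalMean f c)
      (sphericalMean (Laplacian.laplacian f) c) where
  differentiable r := (hasDerivAt_sphericalMean (hf.of_le one_le_two) c r).differentiableAt
  hasDerivAt_flux r := by
    obtain ⟨d, hd⟩ := Nat.exists_eq_add_of_le' hn
    have hidentity := smul_sphericalMean_laplacian hf c r
    have hderiv := (hasDerivAt_deriv_sphericalMean hf c r).differentiableAt.hasDerivAt
    rw [hd] at hidentity ⊢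
    refine ((hasDerivAt_pow (d + 1) r).mul hderiv).congr_deriv ?_
    push_cast [smul_eq_mul] at hidentity ⊢
    linear_combination -r ^ d * hidentity

/-! ### Asymptotics of radial polyharmonic functions -/

section Asymptotics

theorem antitoneOn_Ici_of_hasDerivAt_nonpos {f f' : ℝ → ℝ} {R : ℝ}
    (hf : ∀ x ≥ R, HasDerivAt f (f' x) x) (hf' : ∀ x ≥ R, f' x ≤ 0) : AntitoneOn f (Ici R) :=
  antitoneOn_of_hasDerivWithinAt_nonpos (f' := f') (convex_Ici R)
    (fun x hx => (hf x hx).continuousAt.continuousWithinAt)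
    (fun x hx => (hf x (interior_subset hx)).hasDerivWithinAt)
    (fun x hx => hf' x (interior_subset hx))

theorem eventually_div_lt_of_hasDerivAt {f f' g g' : ℝ → ℝ} {B C : ℝ} (hBC : B < C)
    (hf : ∀ᶠ x in atTop, HasDerivAt f (f' x) x) (hg : ∀ᶠ x in atTop, HasDerivAt g (g' x) x)
    (hg_top : Tendsto g atTop atTop) (hle : ∀ᶠ x in atTop, f' x ≤ B * g' x) :
    ∀ᶠ x in atTop, f x / g x < C := by
  obtain ⟨R, hR⟩ := eventually_atTop.1 (hf.and (hg.and hle))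
  have hanti : AntitoneOn (fun x => f x - B * g x) (Ici R) :=
    antitoneOn_Ici_of_hasDerivAt_nonpos
      (fun x hx => (hR x hx).1.sub ((hR x hx).2.1.const_mul B))
      (fun x hx => sub_nonpos.2 (hR x hx).2.2)
  filter_upwards [eventually_ge_atTop R, hg_top.eventually_gt_atTop 0,
    hg_top.eventually_gt_atTop ((f R - B * g R) / (C - B))] with x hx hpos hlarge
  rw [div_lt_iff₀ (sub_pos.2 hBC)] at hlarge
  rw [div_lt_iff₀ hpos]
  linarith [hanti self_mem_Ici hx hx]

theorem lhopital_atTop_of_hasDerivAt {f f' g g' : ℝ → ℝ} {A : ℝ}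
    (hf : ∀ᶠ x in atTop, HasDerivAt f (f' x) x) (hg : ∀ᶠ x in atTop, HasDerivAt g (g' x) x)
    (hg' : ∀ᶠ x in atTop, 0 < g' x) (hg_top : Tendsto g atTop atTop)
    (hlim : Tendsto (fun x => f' x / g' x) atTop (𝓝 A)) :
    Tendsto (fun x => f x / g x) atTop (𝓝 A) := by
  refine tendsto_order.2 ⟨fun C hC => ?_, fun C hC => ?_⟩
  · obtain ⟨B, hCB, hBA⟩ := exists_between hC
    filter_upwards [eventually_div_lt_of_hasDerivAt (neg_lt_neg hCB) (hf.mono fun x hx => hx.neg)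
      hg hg_top (by
        filter_upwards [hg', hlim.eventually_const_lt hBA] with x hpos hx
        linarith [(lt_div_iff₀ hpos).1 hx])] with x hx
    rw [Pi.neg_apply, neg_div] at hx
    linarith
  · obtain ⟨B, hAB, hBC⟩ := exists_between hC
    refine eventually_div_lt_of_hasDerivAt hBC hf hg hg_top ?_
    filter_upwards [hg', hlim.eventually_lt_const hAB] with x hpos hx
    exact ((div_lt_iff₀ hpos).1 hx).le

theorem tendsto_div_log_of_tendsto_mul_deriv {v : ℝ → ℝ} (hv : Differentiable ℝ v) {a : ℝ}
    (ha : Tendsto (fun r => r * deriv v r) atTop (𝓝 a)) :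
    Tendsto (fun r => v r / Real.log r) atTop (𝓝 a) := by
  refine lhopital_atTop_of_hasDerivAt (.of_forall fun r => (hv r).hasDerivAt) (g' := fun r => r⁻¹)
    ?_ ?_ Real.tendsto_log_atTop (by simpa only [div_inv_eq_mul, mul_comm] using ha)
  all_goals filter_upwards [eventually_gt_atTop 0] with r hr
  exacts [Real.hasDerivAt_log hr.ne', inv_pos.2 hr]

theorem eventually_rpow_le_exp {v : ℝ → ℝ} (hv : Differentiable ℝ v) {a b : ℝ}
    (ha : Tendsto (fun r => r * deriv v r) atTop (𝓝 a)) (hb : b < a) :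
    ∀ᶠ r in atTop, r ^ b ≤ Real.exp (v r) := by
  filter_upwards [(tendsto_div_log_of_tendsto_mul_deriv hv ha).eventually_const_le hb,
    eventually_gt_atTop 1] with r hle hr
  rw [le_div_iff₀ (Real.log_pos hr)] at hle
  rw [Real.rpow_def_of_pos (by linarith)]
  exact Real.exp_le_exp.2 (by linarith)

theorem eventually_exp_le_rpow {v : ℝ → ℝ} (hv : Differentiable ℝ v) {a b : ℝ}
    (ha : Tendsto (fun r => r * deriv v r) atTop (𝓝 a)) (hb : a < b) :
    ∀ᶠ r in atTop, Real.exp (v r) ≤ r ^ b := by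
  filter_upwards [(tendsto_div_log_of_tendsto_mul_deriv hv ha).eventually_le_const hb,
    eventually_gt_atTop 1] with r hle hr
  rw [div_le_iff₀ (Real.log_pos hr)] at hle
  rw [Real.rpow_def_of_pos (by linarith)]
  exact Real.exp_le_exp.2 (by linarith)

theorem tendsto_div_pow_of_tendsto_deriv_div_pow {g g' : ℝ → ℝ} {b : ℕ} {A : ℝ}
    (hg : ∀ᶠ r in atTop, HasDerivAt g (g' r) r)
    (hlim : Tendsto (fun r => g' r / r ^ b) atTop (𝓝 A)) :
    Tendsto (fun r => g r / r ^ (b + 1)) atTop (𝓝 (A / (b + 1))) := by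
  refine lhopital_atTop_of_hasDerivAt (g' := fun r => (b + 1) * r ^ b) hg
    (.of_forall fun r => by simpa using hasDerivAt_pow (b + 1) r) ?_
    (tendsto_pow_atTop b.succ_ne_zero) ?_
  · filter_upwards [eventually_gt_atTop 0] with r hr
    positivity
  · refine (hlim.div_const _).congr fun r => ?_
    rw [div_div, mul_comm]

theorem exists_tendsto_atTop_of_tendsto_deriv_mul_pow {g g' : ℝ → ℝ} {c : ℕ} (hc : 0 < c) {A : ℝ}
    (hg : ∀ᶠ r in atTop, HasDerivAt g (g' r) r)
    (hlim : Tendsto (fun r => g' r * r ^ (c + 1)) atTop (𝓝 A)) :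
    ∃ L, Tendsto g atTop (𝓝 L) := by
  obtain ⟨K, hK⟩ := hlim.norm.isBoundedUnder_le
  obtain ⟨R, hR⟩ := eventually_atTop.1 (hg.and ((eventually_map.1 hK).and (eventually_ge_atTop 1)))
  have hR1 : 1 ≤ R := (hR R le_rfl).2.2
  have hint : IntegrableOn g' (Ioi R) := by
    refine ((integrableOn_Ioi_rpow_of_lt (a := -(c + 1)) (by simpa using hc)
      (by linarith : 0 < R)).const_mul K).mono' ?_ ?_
    · refine (measurable_deriv g).aestronglyMeasurable.congr ?_
      filter_upwards [ae_restrict_mem measurableSet_Ioi] with r hr using (hR r hr.le).1.deriv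
    · filter_upwards [ae_restrict_mem measurableSet_Ioi] with r hr
      have hr0 : 0 < r := by linarith [mem_Ioi.1 hr]
      have hbound := (hR r hr.le).2.1
      rw [norm_mul, Real.norm_of_nonneg (by positivity : 0 ≤ r ^ (c + 1)), ← le_div_iff₀
        (by positivity)] at hbound
      rwa [Real.rpow_neg hr0.le, ← div_eq_mul_inv, ← Nat.cast_add_one, Real.rpow_natCast]
  exact ⟨_, tendsto_limUnder_of_hasDerivAt_of_integrableOn_Ioi (fun r hr => (hR r hr.le).1) hint⟩

theorem tendsto_mul_pow_of_tendsto_deriv_mul_pow {g g' : ℝ → ℝ} {c : ℕ} (hc : 0 < c) {A : ℝ}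
    (hg : ∀ᶠ r in atTop, HasDerivAt g (g' r) r) (hg_zero : Tendsto g atTop (𝓝 0))
    (hlim : Tendsto (fun r => g' r * r ^ (c + 1)) atTop (𝓝 A)) :
    Tendsto (fun r => g r * r ^ c) atTop (𝓝 (-A / c)) := by
  have hinv : ∀ᶠ r : ℝ in atTop,
      HasDerivAt (fun r : ℝ => (r ^ c)⁻¹) (-(c * r ^ (c - 1)) / (r ^ c) ^ 2) r := by
    filter_upwards [eventually_gt_atTop 0] with r hr
    exact (hasDerivAt_pow c r).inv (by positivity)
  have hquotient := HasDerivAt.lhopital_zero_atTop (l := 𝓝 (-A / c)) hg hinv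
    (by
      filter_upwards [eventually_gt_atTop 0] with r hr
      exact div_ne_zero (neg_ne_zero.2 (by positivity)) (by positivity))
    hg_zero (tendsto_pow_atTop hc.ne').inv_tendsto_atTop
    ((hlim.neg.div_const (c : ℝ)).congr' (by
      filter_upwards [eventually_gt_atTop 0] with r hr
      obtain ⟨d, rfl⟩ := Nat.exists_eq_add_of_le' hc
      field_simp
      simp only [Nat.succ_eq_add_one, zero_add, pow_succ, add_tsub_cancel_right, pow_zero, one_mul,
        neg_inj]
      ring))
  simpa only [div_inv_eq_mul] using hquotient

variable {m : ℕ} {F : ℕ → ℝ → ℝ}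
  (hF : ∀ k < m, HasRadialLaplacian (2 * m) (F k) (fun r => -F (k + 1) r))
include hF

theorem eq_zero_of_tendsto_div_pow
    (hbounded : (fun r => r * deriv (F 0) r) =O[atTop] (fun _ => (1 : ℝ))) {i j : ℕ} (hi : i < m)
    (hij : 0 < i + j) {c : ℝ} (hlim : Tendsto (fun r => F i r / r ^ j) atTop (𝓝 c)) : c = 0 := by
  induction i generalizing j c with
  | zero =>
    obtain ⟨b, rfl⟩ := Nat.exists_eq_add_of_le' (show 1 ≤ j by omega)
    have hderiv : Tendsto (fun r => deriv (F 0) r / r ^ b) atTop (𝓝 0) := by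
      have hinv : Tendsto (fun r : ℝ => 1 * (r ^ (b + 1))⁻¹) atTop (𝓝 0) := by
        simpa only [one_mul] using!
          tendsto_inv_atTop_zero.comp (tendsto_pow_atTop (α := ℝ) b.succ_ne_zero)
      refine ((hbounded.mul (Asymptotics.isBigO_refl _ _)).trans_tendsto hinv).congr' ?_
      filter_upwards [eventually_gt_atTop 0] with r hr
      field_simp
      ring
    simpa using tendsto_nhds_unique hlim (tendsto_div_pow_of_tendsto_deriv_div_pow
      (.of_forall fun r => ((hF 0 hi).differentiable r).hasDerivAt) hderiv)
  | succ i ih =>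
    have hflux := tendsto_div_pow_of_tendsto_deriv_div_pow (b := 2 * m - 1 + j)
      (.of_forall (hF i (by omega)).hasDerivAt_flux) (hlim.neg.congr' (by
        filter_upwards [eventually_gt_atTop 0] with r hr
        rw [pow_add, mul_div_mul_left _ _ (by positivity), neg_div]))
    have hderiv : Tendsto (fun r => deriv (F i) r / r ^ (j + 1)) atTop _ :=
      hflux.congr' (by
        filter_upwards [eventually_gt_atTop 0] with r hr
        rw [add_assoc, pow_add, mul_div_mul_left _ _ (by positivity)])
    have hfun := ih (by omega) (by omega) (tendsto_div_pow_of_tendsto_deriv_div_pow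
      (.of_forall fun r => ((hF i (by omega)).differentiable r).hasDerivAt) hderiv)
    rwa [div_eq_zero_iff, or_iff_left (by positivity), div_eq_zero_iff, or_iff_left (by positivity),
      neg_eq_zero] at hfun

theorem tendsto_deriv_mul_pow_of_succ
    (hbounded : (fun r => r * deriv (F 0) r) =O[atTop] (fun _ => (1 : ℝ))) {i j : ℕ}
    (hij : i + j + 2 = m) {A : ℝ}
    (hlim : Tendsto (fun r => deriv (F (i + 1)) r * r ^ (2 * (i + 1) + 1)) atTop (𝓝 A)) :
    Tendsto (fun r => deriv (F i) r * r ^ (2 * i + 1)) atTop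
      (𝓝 (A / (4 * (i + 1) * (j + 1)))) := by
  have hderiv : ∀ᶠ r in atTop, HasDerivAt (F (i + 1)) (deriv (F (i + 1)) r) r :=
    .of_forall fun r => ((hF (i + 1) (by omega)).differentiable r).hasDerivAt
  obtain ⟨L, hL⟩ := exists_tendsto_atTop_of_tendsto_deriv_mul_pow (by omega) hderiv hlim
  obtain rfl : L = 0 :=
    eq_zero_of_tendsto_div_pow hF hbounded (i := i + 1) (j := 0) (by omega) (by omega) (by simpa)
  have hfun := tendsto_mul_pow_of_tendsto_deriv_mul_pow (by omega) hderiv hL hlim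
  have hflux := tendsto_div_pow_of_tendsto_deriv_div_pow (b := 2 * j + 1)
    (.of_forall (hF i (by omega)).hasDerivAt_flux) (hfun.neg.congr' (by
      filter_upwards [eventually_gt_atTop 0] with r hr
      rw [show 2 * m - 1 = 2 * j + 1 + 2 * (i + 1) by omega, pow_add]
      field_simp))
  have hvalue :
      A / (4 * (i + 1) * (j + 1)) = -(-A / (2 * (i + 1) : ℕ)) / ((2 * j + 1 : ℕ) + 1) := by
    push_cast
    field_simp
    ring
  rw [hvalue]
  refine hflux.congr' ?_
  filter_upwards [eventually_gt_atTop 0] with r hr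
  rw [show 2 * m - 1 = (2 * j + 1 + 1) + (2 * i + 1) by omega, pow_add]
  field_simp

open Nat in
theorem tendsto_deriv_mul_pow
    (hbounded : (fun r => r * deriv (F 0) r) =O[atTop] (fun _ => (1 : ℝ))) {I : ℝ}
    (hI : Tendsto (fun r => r ^ (2 * m - 1) * deriv (F (m - 1)) r) atTop (𝓝 (-I))) {i j : ℕ}
    (hij : i + j + 1 = m) :
    Tendsto (fun r => deriv (F i) r * r ^ (2 * i + 1)) atTop
      (𝓝 (-(I * i ! / (4 ^ j * j ! * (m - 1)!)))) := by
  induction j generalizing i with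
  | zero =>
    subst hij
    have : (i ! : ℝ) ≠ 0 := by positivity
    rw [show 2 * (i + 0 + 1) - 1 = 2 * i + 1 by omega] at hI
    simpa [mul_comm, this] using hI
  | succ j ih =>
    convert tendsto_deriv_mul_pow_of_succ hF hbounded (j := j) (by omega) (ih (i := i + 1)
      (by omega)) using 2
    rw [Nat.factorial_succ j, Nat.factorial_succ i]
    push_cast
    field_simp
    ring

open Nat in
theorem tendsto_mul_deriv_of_tendsto_flux (hm : 0 < m)
    (hbounded : (fun r => r * deriv (F 0) r) =O[atTop] (fun _ => (1 : ℝ))) {I : ℝ}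
    (hI : Tendsto (fun r => r ^ (2 * m - 1) * deriv (F (m - 1)) r) atTop (𝓝 (-I))) :
    Tendsto (fun r => r * deriv (F 0) r) atTop (𝓝 (-(I / (4 ^ (m - 1) * (m - 1)! ^ 2)))) := by
  have := tendsto_deriv_mul_pow hF hbounded hI (i := 0) (j := m - 1) (by omega)
  simpa [mul_comm, pow_two, mul_assoc] using this

end Asymptotics

/-! ### Polar coordinates -/

section Polar

theorem lintegral_volumeIoiPow (n : ℕ) {f : ℝ → ℝ≥0∞} (hf : Measurable f) :
    ∫⁻ r : Ioi (0 : ℝ), f r ∂Measure.volumeIoiPow n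
      = ∫⁻ r in Ioi 0, ENNReal.ofReal (r ^ n) * f r := by
  rw [Measure.volumeIoiPow, lintegral_withDensity_eq_lintegral_mul _ (by fun_prop) (by fun_prop)]
  exact lintegral_subtype_comap measurableSet_Ioi fun r => ENNReal.ofReal (r ^ n) * f r

variable {E F : Type*} [NormedAddCommGroup F] [NormedSpace ℝ F]

theorem integrable_volumeIoiPow {n : ℕ} {f : ℝ → F} :
    Integrable (fun r : Ioi (0 : ℝ) => f r) (Measure.volumeIoiPow n)
      ↔ IntegrableOn (fun r => r ^ n • f r) (Ioi 0) := by
  rw [Measure.volumeIoiPow, integrableOn_iff_comap_subtypeVal measurableSet_Ioi,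
    integrable_withDensity_iff_integrable_smul₀' (by fun_prop) (by simp)]
  refine integrable_congr (.of_forall fun r => ?_)
  simp [ENNReal.toReal_ofReal (pow_nonneg r.2.out.le n)]

theorem integral_volumeIoiPow (n : ℕ) (f : ℝ → F) :
    ∫ r : Ioi (0 : ℝ), f r ∂Measure.volumeIoiPow n = ∫ r in Ioi 0, r ^ n • f r := by
  rw [Measure.volumeIoiPow, integral_withDensity_eq_integral_toReal_smul₀ (by fun_prop) (by simp),
    ← integral_subtype_comap measurableSet_Ioi]
  refine integral_congr_ae (.of_forall fun r => ?_)
  simp [ENNReal.toReal_ofReal (pow_nonneg r.2.out.le n)]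

variable [NormedAddCommGroup E]

section NormedSpace

variable [NormedSpace ℝ E]

theorem homeomorphUnitSphereProd_snd_smul_fst (x : ({0}ᶜ : Set E)) :
    ((homeomorphUnitSphereProd E x).2 : ℝ) • ((homeomorphUnitSphereProd E x).1 : E) = x :=
  congrArg Subtype.val ((homeomorphUnitSphereProd E).symm_apply_apply x)

theorem lintegral_eq_lintegral_toSphere [MeasurableSpace E] [BorelSpace E] [FiniteDimensional ℝ E]
    [Nontrivial E] (μ : Measure E) [μ.IsAddHaarMeasure] {f : E → ℝ≥0∞} (hf : Measurable f) :
    ∫⁻ x, f x ∂μ = ∫⁻ s : Metric.sphere (0 : E) 1, ∫⁻ r in Ioi (0 : ℝ),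
      ENNReal.ofReal (r ^ (Module.finrank ℝ E - 1)) * f (r • (s : E)) ∂volume ∂μ.toSphere := by
  calc ∫⁻ x, f x ∂μ = ∫⁻ x : ({0}ᶜ : Set E), f x ∂(μ.comap Subtype.val) := by
        rw [lintegral_subtype_comap (measurableSet_singleton _).compl, restrict_compl_singleton]
    _ = ∫⁻ p : Metric.sphere (0 : E) 1 × Ioi (0 : ℝ), f ((p.2 : ℝ) • (p.1 : E))
          ∂(μ.toSphere.prod (Measure.volumeIoiPow (Module.finrank ℝ E - 1))) := by
      rw [← μ.measurePreserving_homeomorphUnitSphereProd.lintegral_comp (by fun_prop)]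
      simp only [homeomorphUnitSphereProd_snd_smul_fst]
    _ = _ := by
      rw [lintegral_prod _ (Measurable.aemeasurable (by fun_prop))]
      exact lintegral_congr fun s =>
        lintegral_volumeIoiPow _ (f := fun r => f (r • (s : E))) (by fun_prop)

end NormedSpace

variable [InnerProductSpace ℝ E] [FiniteDimensional ℝ E] [MeasurableSpace E] [BorelSpace E]

variable (E) in
/-- The area of the unit sphere. -/
def sphereArea : ℝ := (volume : Measure E).toSphere.real univ

variable [Nontrivial E]

theorem toSphere_univ_ne_zero : (volume : Measure E).toSphere univ ≠ 0 :=
  Measure.measure_univ_ne_zero.2 (Measure.toSphere_ne_zero _)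

variable (E) in
theorem sphereArea_pos : 0 < sphereArea E :=
  ENNReal.toReal_pos toSphere_univ_ne_zero (measure_ne_top volume.toSphere _)

theorem measurePreserving_polar : MeasurePreserving (homeomorphUnitSphereProd E)
    ((volume : Measure E).comap Subtype.val)
    ((volume : Measure E).toSphere univ •
      (uniformSphere E).prod (Measure.volumeIoiPow (Module.finrank ℝ E - 1))) := by
  have hsphere : (volume : Measure E).toSphere univ • uniformSphere E = volume.toSphere := by
    rw [uniformSphere, smul_smul, ENNReal.mul_inv_cancel toSphere_univ_ne_zero
      (measure_ne_top volume.toSphere _), one_smul]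
  rw [← Measure.prod_smul_left, hsphere]
  exact volume.measurePreserving_homeomorphUnitSphereProd

variable {f : E → F}

omit [NormedSpace ℝ F] in
theorem integrable_polar (hf : Integrable f) (c : E) :
    Integrable (fun p : Metric.sphere (0 : E) 1 × Ioi (0 : ℝ) => f (c + (p.2 : ℝ) • (p.1 : E)))
      ((uniformSphere E).prod (Measure.volumeIoiPow (Module.finrank ℝ E - 1))) := by
  refine (integrable_smul_measure (toSphere_univ_ne_zero (E := E))
    (measure_ne_top volume.toSphere _)).1 ?_
  rw [← measurePreserving_polar.integrable_comp_emb
    (homeomorphUnitSphereProd E).measurableEmbedding]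
  simp only [Function.comp_def, homeomorphUnitSphereProd_snd_smul_fst]
  exact (integrableOn_iff_comap_subtypeVal (measurableSet_singleton (0 : E)).compl).1
    (hf.comp_add_left c).integrableOn

theorem integrableOn_pow_smul_sphericalMean (hf : Integrable f) (c : E) :
    IntegrableOn (fun r => r ^ (Module.finrank ℝ E - 1) • sphericalMean f c r) (Ioi 0) :=
  integrable_volumeIoiPow.1 (integrable_polar hf c).integral_prod_right

theorem integral_eq_integral_sphericalMean (hf : Integrable f) (c : E) :
    ∫ x, f x = sphereArea E •
      ∫ r in Ioi (0 : ℝ), r ^ (Module.finrank ℝ E - 1) • sphericalMean f c r := by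
  calc ∫ x, f x = ∫ x : ({0}ᶜ : Set E), f (c + x) ∂(volume.comap Subtype.val) := by
        rw [integral_subtype_comap (measurableSet_singleton _).compl (fun x => f (c + x)),
          restrict_compl_singleton, integral_add_left_eq_self f c]
    _ = sphereArea E • ∫ p : Metric.sphere (0 : E) 1 × Ioi (0 : ℝ), f (c + (p.2 : ℝ) • (p.1 : E))
          ∂(uniformSphere E).prod (Measure.volumeIoiPow (Module.finrank ℝ E - 1)) := by
      rw [sphereArea, measureReal_def, ← integral_smul_measure,
        ← measurePreserving_polar.integral_comp
          (homeomorphUnitSphereProd E).measurableEmbedding]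
      simp only [homeomorphUnitSphereProd_snd_smul_fst]
    _ = _ := by
      rw [integral_prod_symm _ (integrable_polar hf c)]
      exact congrArg _ (integral_volumeIoiPow _ (sphericalMean f c))

end Polar

/-! ### Radial differential inequalities -/

namespace HasRadialLaplacian

variable {n : ℕ} {v L : ℝ → ℝ} (hv : HasRadialLaplacian n v L)
include hv

theorem hasDerivAt (r : ℝ) : HasDerivAt v (deriv v r) r :=
  (hv.differentiable r).hasDerivAt

theorem exp_const_mul (a : ℝ) :
    HasRadialLaplacian n (fun r => Real.exp (a * v r))
      (fun r => Real.exp (a * v r) * (a * L r + a ^ 2 * deriv v r ^ 2)) := by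
  have hexp (r : ℝ) :
      HasDerivAt (fun t => Real.exp (a * v t)) (Real.exp (a * v r) * (a * deriv v r)) r :=
    ((hv.hasDerivAt r).const_mul a).exp
  refine ⟨fun r => (hexp r).differentiableAt, fun r => ?_⟩
  have hflux := ((hv.hasDerivAt_flux r).mul (hexp r)).const_mul a
  refine (hflux.congr_of_eventuallyEq (.of_forall fun t => ?_)).congr_deriv (by ring)
  simp only [(hexp t).deriv, Pi.mul_apply]
  ring

theorem antitoneOn_flux {R : ℝ} (hR : 0 ≤ R) (hL : ∀ r ≥ R, L r ≤ 0) :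
    AntitoneOn (fun r => r ^ (n - 1) * deriv v r) (Ici R) :=
  antitoneOn_Ici_of_hasDerivAt_nonpos (fun r _ => hv.hasDerivAt_flux r)
    fun r hr => mul_nonpos_of_nonneg_of_nonpos (pow_nonneg (hR.trans hr) _) (hL r hr)

/-- Compare with the fundamental solution `r ^ (2 - n)`. -/
theorem antitoneOn_add_mul_inv_pow (hn : 2 < n) {R q : ℝ} (hR : 0 < R)
    (hflux : ∀ r ≥ R, r ^ (n - 1) * deriv v r ≤ q) :
    AntitoneOn (fun r => v r + q / (n - 2) * (r ^ (n - 2))⁻¹) (Ici R) := by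
  obtain ⟨d, rfl⟩ := Nat.exists_eq_add_of_le' (show 3 ≤ n from hn)
  have hinv (r : ℝ) (hr : 0 < r) :
      HasDerivAt (fun t : ℝ => (t ^ (d + 1))⁻¹) (-((d + 1) / r ^ (d + 2))) r := by
    refine ((hasDerivAt_pow (d + 1) r).inv (by positivity)).congr_deriv ?_
    push_cast
    field_simp
    simp only [pow_succ, pow_zero, one_mul, neg_inj]
    ring
  refine antitoneOn_Ici_of_hasDerivAt_nonpos (fun r hr =>
    (hv.hasDerivAt r).add ((hinv r (hR.trans_le hr)).const_mul _)) fun r hr => ?_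
  have hr0 : 0 < r := hR.trans_le hr
  have hle : deriv v r ≤ q / r ^ (d + 2) := by
    rw [le_div_iff₀ (by positivity), mul_comm]
    exact hflux r hr
  have hcoeff : q / ((d + 3 : ℕ) - 2) * -((d + 1) / r ^ (d + 2)) = -(q / r ^ (d + 2)) := by
    rw [show ((d + 3 : ℕ) : ℝ) - 2 = d + 1 by push_cast; ring]
    field_simp
  linarith

theorem neg_mul_le_mul_deriv (hn : 2 < n) {R : ℝ} (hR : 0 < R) (hL : ∀ r ≥ R, L r ≤ 0)
    (hv_nonneg : ∀ r ≥ R, 0 ≤ v r) : -((n - 2) * v R) ≤ R * deriv v R := by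
  have hn' : (0 : ℝ) < n - 2 := sub_pos.2 (by exact_mod_cast hn)
  let q := R ^ (n - 1) * deriv v R
  have hanti := hv.antitoneOn_add_mul_inv_pow hn hR (q := q) fun r hr =>
    hv.antitoneOn_flux hR.le hL self_mem_Ici hr hr
  have hlim : Tendsto (fun r : ℝ => q / (n - 2) * (r ^ (n - 2))⁻¹) atTop (𝓝 0) := by
    simpa only [mul_zero] using! (tendsto_inv_atTop_zero.comp
      (tendsto_pow_atTop (Nat.sub_pos_of_lt hn).ne')).const_mul (q / (n - 2))
  have hnonneg : 0 ≤ v R + q / (n - 2) * (R ^ (n - 2))⁻¹ := by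
    refine le_of_tendsto hlim ?_
    filter_upwards [eventually_ge_atTop R] with r hr
    linarith [hv_nonneg r hr, hanti self_mem_Ici hr hr]
  have hvalue : q / (n - 2) * (R ^ (n - 2))⁻¹ = R * deriv v R / (n - 2) := by
    simp only [q, show n - 1 = n - 2 + 1 by omega, pow_succ]
    field_simp
  rw [hvalue, ← neg_le_iff_add_nonneg', le_div_iff₀ hn'] at hnonneg
  linarith

theorem antitoneOn_Icc_zero (hn : 2 ≤ n) {R : ℝ} (hL : ∀ r ∈ Ioo 0 R, L r ≤ 0) :
    AntitoneOn v (Icc 0 R) := by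
  have hflux_anti : AntitoneOn (fun r => r ^ (n - 1) * deriv v r) (Icc 0 R) := by
    refine antitoneOn_of_hasDerivWithinAt_nonpos (convex_Icc 0 R)
      (fun r _ => (hv.hasDerivAt_flux r).continuousAt.continuousWithinAt)
      (fun r _ => (hv.hasDerivAt_flux r).hasDerivWithinAt) fun r hr => ?_
    rw [interior_Icc] at hr
    exact mul_nonpos_of_nonneg_of_nonpos (pow_nonneg hr.1.le _) (hL r hr)
  refine antitoneOn_of_hasDerivWithinAt_nonpos (convex_Icc 0 R)
    hv.differentiable.continuous.continuousOn (fun r _ => (hv.hasDerivAt r).hasDerivWithinAt)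
    fun r hr => ?_
  rw [interior_Icc] at hr
  have hflux := hflux_anti (left_mem_Icc.2 (hr.1.trans hr.2).le) (Ioo_subset_Icc_self hr) hr.1.le
  simp only [zero_pow (show n - 1 ≠ 0 by omega), zero_mul] at hflux
  exact nonpos_of_mul_nonpos_right hflux (pow_pos hr.1 _)

theorem le_add_of_pow_mul_deriv_le (hn : 2 < n) {R A : ℝ} (hR : 0 < R) (hA : 0 ≤ A)
    (hL : ∀ r ∈ Ioo 0 R, L r ≤ 0) (hflux : ∀ r ≥ R, r ^ (n - 1) * deriv v r ≤ A) {r : ℝ}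
    (hr : 0 ≤ r) : v r ≤ v 0 + A / (n - 2) * (R ^ (n - 2))⁻¹ := by
  have hn' : (0 : ℝ) < n - 2 := sub_pos.2 (by exact_mod_cast hn)
  have hanti := hv.antitoneOn_Icc_zero hn.le hL
  rcases le_total r R with hrR | hRr
  · have hle : v r ≤ v 0 := hanti (left_mem_Icc.2 hR.le) ⟨hr, hrR⟩ hr
    have : 0 ≤ A / (n - 2) * (R ^ (n - 2))⁻¹ := by positivity
    linarith
  · have hle := hv.antitoneOn_add_mul_inv_pow hn hR hflux self_mem_Ici hRr hRr
    have hle0 : v R ≤ v 0 := hanti (left_mem_Icc.2 hR.le) (right_mem_Icc.2 hR.le) hR.le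
    have : 0 ≤ A / (n - 2) * (r ^ (n - 2))⁻¹ := by positivity
    linarith

theorem eventually_mul_deriv_lt (hn : 2 < n) {B C : ℝ} (hBC : B < C)
    (hL : ∀ᶠ r in atTop, r ^ 2 * L r ≤ (n - 2) * B) : ∀ᶠ r in atTop, r * deriv v r < C := by
  obtain ⟨d, rfl⟩ := Nat.exists_eq_add_of_le' (show 3 ≤ n from hn)
  filter_upwards [eventually_gt_atTop 0, eventually_div_lt_of_hasDerivAt hBC
    (.of_forall hv.hasDerivAt_flux) (.of_forall (hasDerivAt_pow (d + 1)))
    (tendsto_pow_atTop d.succ_ne_zero) (by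
      filter_upwards [eventually_gt_atTop 0, hL] with r hr hle
      have hscaled := mul_le_mul_of_nonneg_left hle (pow_nonneg hr.le d)
      push_cast at hscaled ⊢
      calc r ^ (d + 2) * L r = r ^ d * (r ^ 2 * L r) := by ring
        _ ≤ r ^ d * ((d + 3 - 2) * B) := hscaled
        _ = B * ((d + 1) * r ^ d) := by ring)] with r hr hlt
  convert hlt using 1
  rw [show d + 3 - 1 = d + 1 + 1 from rfl, pow_succ]
  field_simp

theorem eventually_mul_deriv_lt_of_nonpos (hn : 2 < n) {C : ℝ} (hC : 0 < C)
    (hL : ∀ᶠ r in atTop, L r ≤ 0) : ∀ᶠ r in atTop, r * deriv v r < C :=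
  hv.eventually_mul_deriv_lt hn hC <| hL.mono fun r hr => by
    simpa only [mul_zero] using mul_nonpos_of_nonneg_of_nonpos (sq_nonneg r) hr

/-- The radial Riccati inequality says that `exp ((n - 2) / 2 * v)` is superharmonic. -/
theorem eventually_neg_two_le_mul_deriv (hn : 2 < n)
    (hL : ∀ᶠ r in atTop, L r ≤ -((n - 2) / 2 * deriv v r ^ 2)) :
    ∀ᶠ r in atTop, -2 ≤ r * deriv v r := by
  have hn' : (0 : ℝ) < (n - 2) / 2 := by
    have : (2 : ℝ) < n := by exact_mod_cast hn
    linarith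
  obtain ⟨R, hR⟩ := eventually_atTop.1 hL
  filter_upwards [eventually_ge_atTop R, eventually_gt_atTop 0] with r hr hr0
  have hle := (hv.exp_const_mul ((n - 2) / 2)).neg_mul_le_mul_deriv hn hr0 (fun s hs =>
    mul_nonpos_of_nonneg_of_nonpos (Real.exp_pos _).le (by
      linarith [mul_le_mul_of_nonneg_left (hR s (hr.trans hs)) hn'.le]))
    fun s _ => (Real.exp_pos _).le
  rw [(((hv.hasDerivAt r).const_mul _).exp).deriv] at hle
  have hprod : 0 ≤ (Real.exp ((n - 2) / 2 * v r) * ((n - 2) / 2)) * (2 + r * deriv v r) := by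
    linarith
  linarith [nonneg_of_mul_nonneg_right hprod (by positivity)]

theorem isBigO_mul_deriv (hn : 2 < n)
    (hL : ∀ᶠ r in atTop, L r ≤ -((n - 2) / 2 * deriv v r ^ 2)) :
    (fun r => r * deriv v r) =O[atTop] fun _ => (1 : ℝ) := by
  have hn' : (2 : ℝ) < n := by exact_mod_cast hn
  have hL_nonpos : ∀ᶠ r in atTop, L r ≤ 0 := hL.mono fun r hr =>
    hr.trans (neg_nonpos.2 (mul_nonneg (by linarith) (sq_nonneg _)))
  refine .of_bound 2 ?_
  filter_upwards [hv.eventually_neg_two_le_mul_deriv hn hL,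
    hv.eventually_mul_deriv_lt_of_nonpos hn two_pos hL_nonpos] with r hlower hupper
  rw [norm_one, mul_one, Real.norm_eq_abs]
  exact abs_le.2 ⟨hlower, hupper.le⟩

variable {α : ℝ} (hα : Tendsto (fun r => r * deriv v r) atTop (𝓝 (-α)))
include hα

theorem nonneg_of_tendsto_mul_deriv (hn : 2 < n) (hL : ∀ᶠ r in atTop, L r ≤ 0) : 0 ≤ α := by
  refine neg_nonpos.1 (le_of_forall_pos_le_add fun ε hε => ?_)
  rw [zero_add]
  exact le_of_tendsto hα ((hv.eventually_mul_deriv_lt_of_nonpos hn hε hL).mono fun r => le_of_lt)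

theorem one_sub_half_le_of_tendsto_mul_deriv (hn : 2 < n) {c p : ℝ} (hc : 0 < c)
    (hL : ∀ᶠ r in atTop, L r ≤ -(c * r ^ (-p) * Real.exp (2 * v r))) : 1 - p / 2 ≤ α := by
  by_contra! hlt
  obtain ⟨β, hαβ, hβp⟩ := exists_between hlt
  have : (0 : ℝ) < n - 2 := sub_pos.2 (by exact_mod_cast hn)
  have hgrow : Tendsto (fun r : ℝ => c * r ^ (2 - p - 2 * β)) atTop atTop :=
    (tendsto_rpow_atTop (by linarith)).const_mul_atTop hc
  have hsmall : ∀ᶠ r in atTop, r ^ 2 * L r ≤ (n - 2) * (-α - 1) := by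
    filter_upwards [hL, eventually_rpow_le_exp hv.differentiable hα (neg_lt_neg hαβ),
      hgrow.eventually_ge_atTop ((n - 2) * (α + 1)), eventually_gt_atTop 0]
      with r hle hexp hlarge hr
    calc r ^ 2 * L r ≤ r ^ 2 * -(c * r ^ (-p) * Real.exp (2 * v r)) := by gcongr
      _ = -(c * r ^ 2 * r ^ (-p) * Real.exp (v r) ^ 2) := by
        rw [← Real.exp_nat_mul]
        push_cast
        ring
      _ ≤ -(c * r ^ 2 * r ^ (-p) * (r ^ (-β)) ^ 2) := by gcongr
      _ = -(c * r ^ (2 - p - 2 * β)) := by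
        rw [show 2 - p - 2 * β = (2 : ℕ) + -p + (-β) * (2 : ℕ) by push_cast; ring, Real.rpow_add hr,
          Real.rpow_add hr, Real.rpow_mul hr.le, Real.rpow_natCast, Real.rpow_natCast]
        ring
      _ ≤ (n - 2) * (-α - 1) := by linarith
  have hlimit := le_of_tendsto hα ((hv.eventually_mul_deriv_lt hn (B := -α - 1) (C := -α - 1 / 2)
    (by linarith) hsmall).mono fun r => le_of_lt)
  linarith

end HasRadialLaplacian

/-! ### The scalar curvature of a conformal metric -/

section ScalarCurvature

variable {n : ℕ} {u : EuclideanSpace ℝ (Fin n) → ℝ}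

theorem partialDeriv_partialDeriv (hu : ContDiff ℝ 2 u) (i j : Fin n)
    (x : EuclideanSpace ℝ (Fin n)) :
    partialDeriv i (partialDeriv j u) x =
      fderiv ℝ (fderiv ℝ u) x (EuclideanSpace.single i 1) (EuclideanSpace.single j 1) :=
  congrArg (· (EuclideanSpace.single i 1)) <| HasFDerivAt.fderiv <|
    ((ContinuousLinearMap.apply ℝ ℝ (EuclideanSpace.single j 1)).hasFDerivAt).comp x
      ((hu.fderiv_right (m := 1) le_rfl).differentiable one_ne_zero x).hasFDerivAt

theorem laplacian_eq_sum_partialDeriv (hu : ContDiff ℝ 2 u) (x : EuclideanSpace ℝ (Fin n)) :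
    Laplacian.laplacian u x = ∑ i, partialDeriv i (partialDeriv i u) x := by
  simp only [laplacian_eq_sum_fderiv_fderiv (EuclideanSpace.basisFun (Fin n) ℝ),
    EuclideanSpace.basisFun_apply, partialDeriv_partialDeriv hu]

theorem sum_partialDeriv_sq (u : EuclideanSpace ℝ (Fin n) → ℝ) (x : EuclideanSpace ℝ (Fin n)) :
    ∑ i, partialDeriv i u x ^ 2 = ‖fderiv ℝ u x‖ ^ 2 := by
  simp only [(EuclideanSpace.basisFun (Fin n) ℝ).norm_dual, EuclideanSpace.basisFun_apply,
    partialDeriv]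

theorem conformalMetric_inv (u : EuclideanSpace ℝ (Fin n) → ℝ) (x : EuclideanSpace ℝ (Fin n)) :
    (conformalMetric u x)⁻¹ = Real.exp (-(2 * u x)) • 1 := by
  refine Matrix.inv_eq_right_inv ?_
  rw [conformalMetric, Matrix.smul_mul, Matrix.mul_smul, smul_smul, ← Real.exp_add]
  simp

theorem partialDeriv_conformalMetric {x : EuclideanSpace ℝ (Fin n)} (hu : DifferentiableAt ℝ u x)
    (i j k : Fin n) :
    partialDeriv i (fun y => conformalMetric u y j k) x =
      2 * Real.exp (2 * u x) * if j = k then partialDeriv i u x else 0 := by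
  split_ifs with h
  · simp only [partialDeriv, conformalMetric, h, Matrix.smul_apply, Matrix.one_apply_eq,
      smul_eq_mul, mul_one, (hu.hasFDerivAt.const_mul 2).exp.fderiv, smul_apply]
    ring
  · simp [conformalMetric, h, partialDeriv]

theorem christoffel_conformalMetric (hu : Differentiable ℝ u) (k i j : Fin n) :
    christoffel (conformalMetric u) k i j = fun x =>
      (if j = k then partialDeriv i u x else 0) + (if i = k then partialDeriv j u x else 0)
        - (if i = j then partialDeriv k u x else 0) := by
  funext x
  simp only [christoffel, partialDeriv_conformalMetric (hu x), conformalMetric_inv,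
    Matrix.smul_apply, Matrix.one_apply, smul_eq_mul, mul_ite, mul_one, mul_zero, ite_mul,
    zero_mul, Finset.sum_ite_eq, Finset.mem_univ, if_true, Real.exp_neg]
  split_ifs <;> field_simp <;> ring

theorem partialDeriv_christoffel_conformalMetric (hu : ContDiff ℝ 2 u) (l k i j : Fin n)
    (x : EuclideanSpace ℝ (Fin n)) :
    partialDeriv l (christoffel (conformalMetric u) k i j) x =
      (if j = k then partialDeriv l (partialDeriv i u) x else 0)
        + (if i = k then partialDeriv l (partialDeriv j u) x else 0)
        - (if i = j then partialDeriv l (partialDeriv k u) x else 0) := by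
  have hdiff (p : Prop) [Decidable p] (i : Fin n) :
      HasFDerivAt (fun y => if p then partialDeriv i u y else 0)
        (if p then fderiv ℝ (partialDeriv i u) x else 0) x := by
    split_ifs
    · exact (((hu.fderiv_right (m := 1) le_rfl).clm_apply contDiff_const).differentiable
        one_ne_zero x).hasFDerivAt
    · exact hasFDerivAt_const _ _
  rw [christoffel_conformalMetric (hu.differentiable two_ne_zero), partialDeriv,
    (((hdiff (j = k) i).fun_add (hdiff (i = k) j)).fun_sub (hdiff (i = j) k)).fderiv]
  simp only [sub_apply, add_apply, partialDeriv]
  split_ifs <;> rfl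

theorem ricci_conformalMetric_self (hu : ContDiff ℝ 2 u) (i : Fin n)
    (x : EuclideanSpace ℝ (Fin n)) :
    ricci (conformalMetric u) i i x =
      (2 - n) * partialDeriv i (partialDeriv i u) x - Laplacian.laplacian u x
        + (n - 2) * (partialDeriv i u x ^ 2 - ‖fderiv ℝ u x‖ ^ 2) := by
  rw [laplacian_eq_sum_partialDeriv hu, ← sum_partialDeriv_sq]
  simp only [ricci, partialDeriv_christoffel_conformalMetric hu]
  simp only [christoffel_conformalMetric (hu.differentiable two_ne_zero), if_true,
    Finset.sum_sub_distrib, Finset.sum_add_distrib, add_mul, mul_add, sub_mul, mul_sub, ite_mul,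
    mul_ite, zero_mul, mul_zero, Finset.sum_ite_eq, Finset.sum_ite_eq', Finset.mem_univ,
    Finset.sum_const, Finset.card_univ, Fintype.card_fin, nsmul_eq_mul, Finset.sum_ite_irrel,
    ← pow_two]
  ring

theorem scalarCurvature_conformalMetric (hu : ContDiff ℝ 2 u) (x : EuclideanSpace ℝ (Fin n)) :
    scalarCurvature (conformalMetric u) x =
      -(Real.exp (-(2 * u x)) *
        ((n - 1) * (2 * Laplacian.laplacian u x + (n - 2) * ‖fderiv ℝ u x‖ ^ 2))) := by
  have htrace : scalarCurvature (conformalMetric u) x =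
      Real.exp (-(2 * u x)) * ∑ i, ricci (conformalMetric u) i i x := by
    simp only [scalarCurvature, conformalMetric_inv, Matrix.smul_apply, Matrix.one_apply,
      smul_eq_mul, mul_ite, mul_one, mul_zero, ite_mul, zero_mul, Finset.sum_ite_eq,
      Finset.mem_univ, if_true, Finset.mul_sum]
  simp only [htrace, ricci_conformalMetric_self hu, Finset.sum_sub_distrib,
    Finset.sum_add_distrib, ← Finset.mul_sum, sum_partialDeriv_sq,
    ← laplacian_eq_sum_partialDeriv hu, Finset.sum_const, Finset.card_univ, Fintype.card_fin,
    nsmul_eq_mul]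
  ring

end ScalarCurvature

/-! ### Volumes of spheres -/

theorem sphereArea_euclideanSpace (n : ℕ) :
    sphereArea (EuclideanSpace ℝ (Fin (n + 1))) =
      2 * √Real.pi ^ (n + 1) / Real.Gamma ((n + 1) / 2) := by
  rw [sphereArea, Measure.toSphere_real_apply_univ, finrank_euclideanSpace_fin, measureReal_def,
    EuclideanSpace.volume_ball, Fintype.card_fin, ENNReal.ofReal_one, one_pow, one_mul,
    ENNReal.toReal_ofReal (by positivity)]
  push_cast
  rw [Real.Gamma_add_one (by positivity)]
  field_simp

theorem factorial_mul_sphereVolume (m : ℕ) :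
    ((2 * (m + 1) - 1).factorial : ℝ) * sphereVolume (2 * (m + 1)) / 2 =
      sphereArea (EuclideanSpace ℝ (Fin (2 * (m + 1)))) * (4 ^ m * (m.factorial : ℝ) ^ 2) := by
  have hfactorial : Real.Gamma (2 * (m + 1)) = (2 * m + 1).factorial := by
    rw [← Real.Gamma_nat_eq_factorial]
    congr 1
    push_cast
    ring
  have hpow : (2 : ℝ) ^ (1 - 2 * ((m : ℝ) + 1)) = (2 * 4 ^ m)⁻¹ := by
    rw [show 1 - 2 * ((m : ℝ) + 1) = -((2 * m + 1 : ℕ) : ℝ) by push_cast; ring,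
      Real.rpow_neg two_pos.le, Real.rpow_natCast, pow_succ', pow_mul]
    norm_num
  have hduplication := Real.Gamma_mul_Gamma_add_half (m + 1)
  rw [hpow, hfactorial, Real.Gamma_nat_eq_factorial] at hduplication
  have hodd : sphereVolume (2 * (m + 1)) =
      2 * √Real.pi ^ (2 * m + 3) / Real.Gamma (m + 1 + 1 / 2) := by
    refine (sphereArea_euclideanSpace (2 * (m + 1))).trans ?_
    push_cast
    ring_nf
  have heven : sphereArea (EuclideanSpace ℝ (Fin (2 * (m + 1)))) =
      2 * √Real.pi ^ (2 * m + 2) / m.factorial := by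
    refine (sphereArea_euclideanSpace (2 * m + 1)).trans ?_
    rw [← Real.Gamma_nat_eq_factorial]
    push_cast
    ring_nf
  have : 0 < Real.Gamma ((m : ℝ) + 1 + 1 / 2) := Real.Gamma_pos_of_pos (by positivity)
  rw [hodd, heven, show 2 * (m + 1) - 1 = 2 * m + 1 by omega]
  field_simp at hduplication ⊢
  linear_combination -√Real.pi ^ (2 * m + 2) * hduplication

/-! ### Spherical means of the conformal factor -/

section InnerProductSpace

variable {E : Type*} [NormedAddCommGroup E] [InnerProductSpace ℝ E] [FiniteDimensional ℝ E]

theorem contDiff_laplacian {k : ℕ} {f : E → ℝ} (hf : ContDiff ℝ (k + 2 : ℕ) f) :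
    ContDiff ℝ k (Laplacian.laplacian f) := by
  rw [funext (laplacian_eq_sum_fderiv_fderiv (stdOrthonormalBasis ℝ E) f)]
  have hf' : ContDiff ℝ k (fderiv ℝ (fderiv ℝ f)) :=
    ContDiff.fderiv_right (m := k) (n := (k + 1 : ℕ)) (hf.fderiv_right le_rfl) le_rfl
  exact .sum fun i _ => (hf'.clm_apply contDiff_const).clm_apply contDiff_const

variable [MeasurableSpace E] [BorelSpace E] {f : E → ℝ}

theorem map_sphericalMean_le [Nontrivial E] {φ : ℝ → ℝ} (hφ : ConvexOn ℝ univ φ)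
    (hf : Continuous f) (c : E) (r : ℝ) :
    φ (sphericalMean f c r) ≤ sphericalMean (fun x => φ (f x)) c r := by
  have hφ_continuous : Continuous φ := continuousOn_univ.1 (hφ.continuousOn isOpen_univ)
  exact hφ.map_integral_le hφ_continuous.continuousOn isClosed_univ (.of_forall fun _ => mem_univ _)
    (integrable_uniformSphere (by fun_prop)) (integrable_uniformSphere (by fun_prop))

theorem sq_deriv_sphericalMean_le [Nontrivial E] (hf : ContDiff ℝ 1 f) (c : E) (r : ℝ) :
    deriv (sphericalMean f c) r ^ 2 ≤ sphericalMean (fun x => ‖fderiv ℝ f x‖ ^ 2) c r := by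
  have := hf.continuous_fderiv one_ne_zero
  rw [(hasDerivAt_sphericalMean hf c r).deriv]
  calc (∫ s : Metric.sphere (0 : E) 1, fderiv ℝ f (c + r • (s : E)) s ∂uniformSphere E) ^ 2
      ≤ ∫ s : Metric.sphere (0 : E) 1, fderiv ℝ f (c + r • (s : E)) s ^ 2 ∂uniformSphere E :=
        even_two.convexOn_pow.map_integral_le (continuous_pow 2).continuousOn isClosed_univ
          (.of_forall fun _ => mem_univ _) (integrable_uniformSphere (by fun_prop))
          (integrable_uniformSphere (by unfold Function.comp; fun_prop))
    _ ≤ sphericalMean (fun x => ‖fderiv ℝ f x‖ ^ 2) c r := by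
        refine integral_mono (integrable_uniformSphere (by fun_prop))
          (integrable_uniformSphere (by fun_prop)) fun s => ?_
        refine sq_le_sq.2 ?_
        rw [abs_norm, ← Real.norm_eq_abs]
        simpa using (fderiv ℝ f (c + r • (s : E))).le_opNorm s

theorem pow_mul_deriv_sphericalMean (hn : 2 ≤ Module.finrank ℝ E) (hf : ContDiff ℝ 2 f) (c : E)
    (r : ℝ) :
    r ^ (Module.finrank ℝ E - 1) * deriv (sphericalMean f c) r =
      ∫ t in (0)..r, t ^ (Module.finrank ℝ E - 1) * sphericalMean (Laplacian.laplacian f) c t := by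
  have hcontinuous := continuous_sphericalMean (contDiff_laplacian (k := 0) hf).continuous c
  rw [intervalIntegral.integral_eq_sub_of_hasDerivAt
    (fun t _ => (hasRadialLaplacian_sphericalMean hn hf c).hasDerivAt_flux t)
    (Continuous.intervalIntegrable (by fun_prop) 0 _), zero_pow (by omega), zero_mul, sub_zero]

theorem tendsto_pow_mul_deriv_sphericalMean (hn : 2 ≤ Module.finrank ℝ E) (hf : ContDiff ℝ 2 f)
    (hint : Integrable (Laplacian.laplacian f)) (c : E) :
    Tendsto (fun r => r ^ (Module.finrank ℝ E - 1) * deriv (sphericalMean f c) r) atTop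
      (𝓝 ((∫ x, Laplacian.laplacian f x) / sphereArea E)) := by
  have : Nontrivial E := Module.nontrivial_of_finrank_pos (R := ℝ) (by omega)
  rw [integral_eq_integral_sphericalMean hint c, smul_eq_mul,
    mul_div_cancel_left₀ _ (sphereArea_pos E).ne', funext (pow_mul_deriv_sphericalMean hn hf c)]
  exact intervalIntegral_tendsto_integral_Ioi 0 (integrableOn_pow_smul_sphericalMean hint c)
    tendsto_id

end InnerProductSpace

section ConformalFactor

variable {n : ℕ} {u : EuclideanSpace ℝ (Fin n) → ℝ}

theorem laplacian_le_of_le_scalarCurvature (hn : 2 ≤ n) (hu : ContDiff ℝ 2 u)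
    {x : EuclideanSpace ℝ (Fin n)} {b : ℝ} (hb : b ≤ scalarCurvature (conformalMetric u) x) :
    Laplacian.laplacian u x ≤
      -((n - 2) / 2 * ‖fderiv ℝ u x‖ ^ 2) - b / (2 * (n - 1)) * Real.exp (2 * u x) := by
  have hn' : (0 : ℝ) < n - 1 := sub_pos.2 (by exact_mod_cast hn)
  rw [scalarCurvature_conformalMetric hu, ← mul_neg, Real.exp_neg, inv_mul_eq_div,
    le_div_iff₀ (Real.exp_pos _)] at hb
  have hdiv : b / (2 * (n - 1)) * Real.exp (2 * u x) ≤
      -(Laplacian.laplacian u x) - (n - 2) / 2 * ‖fderiv ℝ u x‖ ^ 2 := by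
    rw [div_mul_eq_mul_div, div_le_iff₀ (by positivity)]
    linarith
  linarith

theorem sphericalMean_laplacian_le (hn : 2 ≤ n) (hu : ContDiff ℝ 2 u) {r b : ℝ} (hr : 0 ≤ r)
    (hb : 0 ≤ b)
    (hcurv : ∀ x : EuclideanSpace ℝ (Fin n), ‖x‖ = r → b ≤ scalarCurvature (conformalMetric u) x) :
    sphericalMean (Laplacian.laplacian u) 0 r ≤
      -((n - 2) / 2 * deriv (sphericalMean u 0) r ^ 2)
        - b / (2 * (n - 1)) * Real.exp (2 * sphericalMean u 0 r) := by
  have hn' : (2 : ℝ) ≤ n := by exact_mod_cast hn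
  have : Nontrivial (EuclideanSpace ℝ (Fin n)) :=
    Module.nontrivial_of_finrank_pos (R := ℝ) (by simp; omega)
  have hlaplacian := (contDiff_laplacian (k := 0) hu).continuous
  have hfderiv := hu.continuous_fderiv two_ne_zero
  have hcontinuous := hu.continuous
  have hexp_convex : ConvexOn ℝ univ fun t : ℝ => Real.exp (2 * t) := by
    simpa using! convexOn_exp.comp_linearMap (LinearMap.mulLeft ℝ (2 : ℝ))
  calc sphericalMean (Laplacian.laplacian u) 0 r
      ≤ sphericalMean (fun x => -((n - 2) / 2 * ‖fderiv ℝ u x‖ ^ 2)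
          - b / (2 * (n - 1)) * Real.exp (2 * u x)) 0 r :=
        sphericalMean_mono hlaplacian (by fun_prop) fun s hs =>
          laplacian_le_of_le_scalarCurvature hn hu (hcurv _ (by
            rw [zero_add, norm_smul, hs, mul_one, Real.norm_of_nonneg hr]))
    _ = -((n - 2) / 2 * sphericalMean (fun x => ‖fderiv ℝ u x‖ ^ 2) 0 r)
          - b / (2 * (n - 1)) * sphericalMean (fun x => Real.exp (2 * u x)) 0 r := by
        simp only [sphericalMean]
        rw [integral_sub (integrable_uniformSphere (by fun_prop))
          (integrable_uniformSphere (by fun_prop)), integral_neg, integral_const_mul,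
          integral_const_mul]
    _ ≤ _ := by
        have hb' : 0 ≤ b / (2 * (n - 1)) := div_nonneg hb (by linarith)
        have : (0 : ℝ) ≤ (n - 2) / 2 := by linarith
        gcongr
        · exact sq_deriv_sphericalMean_le (hu.of_le one_le_two) 0 r
        · exact map_sphericalMean_le hexp_convex hcontinuous 0 r

theorem negLaplacianPow_succ (k : ℕ) (u : EuclideanSpace ℝ (Fin n) → ℝ) :
    negLaplacianPow (k + 1) u = fun x => -(Laplacian.laplacian (negLaplacianPow k u) x) :=
  Function.iterate_succ_apply' ..

theorem contDiff_negLaplacianPow {k l : ℕ} (hu : ContDiff ℝ (2 * k + l : ℕ) u) :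
    ContDiff ℝ l (negLaplacianPow k u) := by
  induction k generalizing l with
  | zero => simpa only [mul_zero, zero_add] using! hu
  | succ k ih =>
    rw [negLaplacianPow_succ]
    exact (contDiff_laplacian (ih (by rwa [add_comm l, ← add_assoc]))).neg

theorem qCurvature_mul_exp (u : EuclideanSpace ℝ (Fin n) → ℝ) (x : EuclideanSpace ℝ (Fin n)) :
    qCurvature u x * Real.exp (n * u x) = negLaplacianPow (n / 2) u x := by
  rw [qCurvature, mul_right_comm, ← Real.exp_add, neg_add_cancel, Real.exp_zero, one_mul]

theorem hasRadialLaplacian_sphericalMean_negLaplacianPow (hn : 2 ≤ n) {k : ℕ}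
    (hu : ContDiff ℝ (2 * (k + 1) : ℕ) u) (c : EuclideanSpace ℝ (Fin n)) :
    HasRadialLaplacian n (sphericalMean (negLaplacianPow k u) c)
      fun r => -sphericalMean (negLaplacianPow (k + 1) u) c r := by
  have hmean := hasRadialLaplacian_sphericalMean (by rwa [finrank_euclideanSpace_fin])
    (contDiff_negLaplacianPow (l := 2) hu) c
  simpa only [finrank_euclideanSpace_fin, negLaplacianPow_succ, sphericalMean, integral_neg,
    neg_neg] using! hmean

/-- The value `(n - 1)! |𝕊ⁿ| / 2`, half of the total Q-curvature of the round sphere. -/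
def halfSphereTotalQ (n : ℕ) : ℝ := ((n - 1).factorial : ℝ) * sphereVolume n / 2

theorem halfSphereTotalQ_pos (n : ℕ) : 0 < halfSphereTotalQ n := by
  have : 0 < sphereVolume n := sphereArea_pos _
  unfold halfSphereTotalQ
  positivity

/-- The total Q-curvature of `e^{2u} |dx|²` in units of `halfSphereTotalQ n`. -/
def normalizedTotalQ (u : EuclideanSpace ℝ (Fin n) → ℝ) : ℝ :=
  (∫ x, qCurvature u x * Real.exp (n * u x)) / halfSphereTotalQ n

theorem tendsto_mul_deriv_sphericalMean (hn : 2 ≤ n) (hn_even : Even n) (hu : ContDiff ℝ n u)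
    (hfinite : Integrable fun x => qCurvature u x * Real.exp (n * u x))
    (hbounded : (fun r => r * deriv (sphericalMean u 0) r) =O[atTop] fun _ => (1 : ℝ)) :
    Tendsto (fun r => r * deriv (sphericalMean u 0) r) atTop (𝓝 (-normalizedTotalQ u)) := by
  obtain ⟨m, rfl⟩ : ∃ m, n = 2 * (m + 1) := by
    obtain ⟨k, rfl⟩ := hn_even.two_dvd
    exact ⟨k - 1, by omega⟩
  have hQ (x) : qCurvature u x * Real.exp ((2 * (m + 1) : ℕ) * u x) =
      -Laplacian.laplacian (negLaplacianPow m u) x := by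
    rw [qCurvature_mul_exp, Nat.mul_div_cancel_left _ two_pos, negLaplacianPow_succ]
  have hflux := tendsto_pow_mul_deriv_sphericalMean (by simp)
    (contDiff_negLaplacianPow (l := 2) hu)
    (integrable_neg_iff.1 ((integrable_congr (.of_forall hQ)).1 hfinite)) 0
  rw [finrank_euclideanSpace_fin, ← neg_neg (_ / _)] at hflux
  have hlim := tendsto_mul_deriv_of_tendsto_flux
    (F := fun k => sphericalMean (negLaplacianPow k u) 0) (fun k hk =>
      hasRadialLaplacian_sphericalMean_negLaplacianPow hn
        (hu.of_le (by exact_mod_cast (by omega))) 0)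
    m.succ_pos hbounded hflux
  rw [normalizedTotalQ, halfSphereTotalQ, factorial_mul_sphereVolume, ← div_div,
    integral_congr_ae (.of_forall hQ), integral_neg, neg_div]
  exact hlim

end ConformalFactor

/-! ### Complete conformal metrics -/

theorem exists_last_mem_Ici {f : ℝ → ℝ} {a b c : ℝ} (hf : ContinuousOn f (Icc a b)) (hab : a ≤ b)
    (ha : c ≤ f a) : ∃ τ ∈ Icc a b, c ≤ f τ ∧ ∀ t ∈ Ioc τ b, f t < c := by
  have hclosed : IsClosed (Icc a b ∩ f ⁻¹' Ici c) :=
    hf.preimage_isClosed_of_isClosed isClosed_Icc isClosed_Ici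
  obtain ⟨τ, hτ, hmax⟩ := (isCompact_Icc.of_isClosed_subset hclosed
    inter_subset_left).exists_isGreatest ⟨a, left_mem_Icc.2 hab, ha⟩
  refine ⟨τ, hτ.1, hτ.2, fun t ht => ?_⟩
  by_contra! hle
  exact ht.1.not_ge (hmax ⟨⟨hτ.1.1.trans ht.1.le, ht.2⟩, hle⟩)

section CompleteMetric

variable {n : ℕ} {u : EuclideanSpace ℝ (Fin n) → ℝ}

theorem tangentNorm_conformalMetric (u : EuclideanSpace ℝ (Fin n) → ℝ)
    (x v : EuclideanSpace ℝ (Fin n)) :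
    tangentNorm (conformalMetric u) x v = Real.exp (u x) * ‖v‖ := by
  have hsq : ∑ i, ∑ j, conformalMetric u x i j * v i * v j = (Real.exp (u x) * ‖v‖) ^ 2 := by
    rw [mul_pow, EuclideanSpace.real_norm_sq_eq, ← Real.exp_nat_mul, Finset.mul_sum]
    simp only [conformalMetric, Matrix.smul_apply, Matrix.one_apply, smul_eq_mul, mul_ite, mul_one,
      mul_zero, ite_mul, zero_mul, Finset.sum_ite_eq, Finset.mem_univ, if_true, Nat.cast_ofNat, sq,
      mul_assoc]
  rw [tangentNorm, hsq, Real.sqrt_sq (by positivity)]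

/-- The norms on the tangent spaces of `ℝⁿ` defined by `e^{2u} |dx|²`, with respect to which
`riemannianDist (conformalMetric u)` is Mathlib's Riemannian distance. -/
abbrev conformalENorm (u : EuclideanSpace ℝ (Fin n) → ℝ) (p : EuclideanSpace ℝ (Fin n)) :
    ENorm (TangentSpace 𝓘(ℝ, EuclideanSpace ℝ (Fin n)) p) :=
  ⟨fun v => ENNReal.ofReal (tangentNorm (conformalMetric u) p v)⟩

theorem enormSMulClass_conformalENorm (u : EuclideanSpace ℝ (Fin n) → ℝ)
    (p : EuclideanSpace ℝ (Fin n)) :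
    letI := conformalENorm u p
    ENormSMulClass ℝ (TangentSpace 𝓘(ℝ, EuclideanSpace ℝ (Fin n)) p) := by
  let := conformalENorm u p
  refine ⟨fun (r : ℝ) (v : EuclideanSpace ℝ (Fin n)) => ?_⟩
  change ENNReal.ofReal (tangentNorm (conformalMetric u) p (r • v)) =
    ‖r‖ₑ * ENNReal.ofReal (tangentNorm (conformalMetric u) p v)
  rw [tangentNorm_conformalMetric, tangentNorm_conformalMetric, norm_smul, ← ofReal_norm,
    ← ENNReal.ofReal_mul (norm_nonneg r), mul_left_comm]

theorem riemannianDist_conformalMetric_comm (u : EuclideanSpace ℝ (Fin n) → ℝ)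
    (x y : EuclideanSpace ℝ (Fin n)) :
    riemannianDist (conformalMetric u) x y = riemannianDist (conformalMetric u) y x := by
  let := conformalENorm u
  have := enormSMulClass_conformalENorm u
  exact Manifold.riemannianEDist_comm

theorem pathELength_conformalENorm (u : EuclideanSpace ℝ (Fin n) → ℝ)
    (γ : ℝ → EuclideanSpace ℝ (Fin n)) (a b : ℝ) :
    letI := conformalENorm u
    Manifold.pathELength 𝓘(ℝ, EuclideanSpace ℝ (Fin n)) γ a b =
      ∫⁻ t in Icc a b, ENNReal.ofReal (Real.exp (u (γ t))) * ‖deriv γ t‖ₑ := by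
  let := conformalENorm u
  rw [Manifold.pathELength_eq_lintegral_mfderiv_Icc]
  refine lintegral_congr fun t => ?_
  rw [mfderiv_eq_fderiv]
  change ENNReal.ofReal (tangentNorm (conformalMetric u) (γ t) (fderiv ℝ γ t 1)) = _
  rw [tangentNorm_conformalMetric, ENNReal.ofReal_mul (Real.exp_pos _).le, ofReal_norm,
    fderiv_apply_one_eq_deriv]

theorem riemannianDist_smul_smul_le (u : EuclideanSpace ℝ (Fin n) → ℝ)
    {s : EuclideanSpace ℝ (Fin n)} (hs : ‖s‖ = 1) {a b : ℝ} (hab : a ≤ b) :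
    riemannianDist (conformalMetric u) (a • s) (b • s) ≤
      ∫⁻ t in Icc a b, ENNReal.ofReal (Real.exp (u (t • s))) := by
  let := conformalENorm u
  have := enormSMulClass_conformalENorm u
  have hderiv (t : ℝ) : deriv (fun t : ℝ => t • s) t = s := by
    simpa using ((hasDerivAt_id t).smul_const s).deriv
  have hsmooth : ContDiff ℝ 1 fun t : ℝ => t • s := by fun_prop
  refine (Manifold.riemannianEDist_le_pathELength (γ := fun t : ℝ => t • s)
    hsmooth.contMDiff.contMDiffOn rfl rfl hab).trans_eq ?_
  simp only [pathELength_conformalENorm, hderiv, ← ofReal_norm, hs, ENNReal.ofReal_one, mul_one]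

theorem mul_enorm_sub_le_pathELength {γ : ℝ → EuclideanSpace ℝ (Fin n)} {a b δ : ℝ}
    (hγ : ContDiffOn ℝ 1 γ (Icc a b)) (hab : a ≤ b) (hδ : ∀ t ∈ Ioo a b, δ ≤ Real.exp (u (γ t))) :
    letI := conformalENorm u
    ENNReal.ofReal δ * ‖γ b - γ a‖ₑ ≤
      Manifold.pathELength 𝓘(ℝ, EuclideanSpace ℝ (Fin n)) γ a b := by
  have hchord := enorm_sub_le_lintegral_derivWithin_Icc_of_contDiffOn_Icc hγ hab
  rw [pathELength_conformalENorm]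
  rw [← restrict_Ioo_eq_restrict_Icc] at hchord ⊢
  calc ENNReal.ofReal δ * ‖γ b - γ a‖ₑ
      ≤ ENNReal.ofReal δ * ∫⁻ t in Ioo a b, ‖derivWithin γ (Icc a b) t‖ₑ := by gcongr
    _ = ∫⁻ t in Ioo a b, ENNReal.ofReal δ * ‖derivWithin γ (Icc a b) t‖ₑ :=
        (lintegral_const_mul' _ _ ENNReal.ofReal_ne_top).symm
    _ ≤ ∫⁻ t in Ioo a b, ENNReal.ofReal (Real.exp (u (γ t))) * ‖deriv γ t‖ₑ := by
        refine setLIntegral_mono' measurableSet_Ioo fun t ht => ?_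
        rw [derivWithin_of_mem_nhds (Icc_mem_nhds ht.1 ht.2)]
        gcongr
        exact hδ t ht

theorem le_riemannianDist_of_forall_mem_ball {x y : EuclideanSpace ℝ (Fin n)} {δ ρ : ℝ}
    (hδ : ∀ z ∈ Metric.ball x ρ, δ ≤ Real.exp (u z)) (hy : ρ ≤ dist y x) :
    ENNReal.ofReal δ * ENNReal.ofReal ρ ≤ riemannianDist (conformalMetric u) y x := by
  let := conformalENorm u
  by_contra! hlt
  obtain ⟨γ, rfl, rfl, hγ, hlength⟩ := Manifold.exists_lt_of_riemannianEDist_lt hlt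
  rw [contMDiffOn_iff_contDiffOn] at hγ
  have hcontinuous : ContinuousOn γ (Icc 0 1) := hγ.continuousOn
  obtain ⟨τ, hτ, hτ_dist, hτ_last⟩ := exists_last_mem_Ici
    (f := fun t => dist (γ t) (γ 1)) (by fun_prop) zero_le_one hy
  refine hlength.not_ge ?_
  calc ENNReal.ofReal δ * ENNReal.ofReal ρ
      ≤ ENNReal.ofReal δ * ‖γ 1 - γ τ‖ₑ := by
        rw [← ofReal_norm, ← dist_eq_norm, dist_comm]
        gcongr
    _ ≤ Manifold.pathELength 𝓘(ℝ, EuclideanSpace ℝ (Fin n)) γ τ 1 :=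
        mul_enorm_sub_le_pathELength (hγ.mono (Icc_subset_Icc_left hτ.1)) hτ.2
          fun t ht => hδ _ (hτ_last t (Ioo_subset_Ioc_self ht))
    _ ≤ Manifold.pathELength 𝓘(ℝ, EuclideanSpace ℝ (Fin n)) γ 0 1 :=
        Manifold.pathELength_mono hτ.1 le_rfl

theorem tendsto_of_tendsto_riemannianDist {ι : Type*} {l : Filter ι} (hu : Continuous u)
    {y : ι → EuclideanSpace ℝ (Fin n)} {x : EuclideanSpace ℝ (Fin n)}
    (hy : Tendsto (fun i => riemannianDist (conformalMetric u) (y i) x) l (𝓝 0)) :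
    Tendsto y l (𝓝 x) := by
  refine Metric.tendsto_nhds.2 fun ρ hρ => ?_
  obtain ⟨z, _, hz⟩ := (isCompact_closedBall x ρ).exists_isMinOn
    ⟨x, Metric.mem_closedBall_self hρ.le⟩ (Real.continuous_exp.comp hu).continuousOn
  have hpos : 0 < ENNReal.ofReal (Real.exp (u z)) * ENNReal.ofReal ρ :=
    ENNReal.mul_pos (ENNReal.ofReal_pos.2 (Real.exp_pos _)).ne' (ENNReal.ofReal_pos.2 hρ).ne'
  filter_upwards [hy.eventually_lt_const hpos] with i hi
  by_contra! hle
  exact hi.not_ge (le_riemannianDist_of_forall_mem_ball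
    (fun w hw => hz (Metric.ball_subset_closedBall hw)) hle)

theorem not_isCompleteMetric_of_lintegral_ray_ne_top (hu : Continuous u)
    {s : EuclideanSpace ℝ (Fin n)} (hs : ‖s‖ = 1) {a : ℝ}
    (hfinite : ∫⁻ t in Ioi a, ENNReal.ofReal (Real.exp (u (t • s))) ≠ ⊤) :
    ¬ IsCompleteMetric (conformalMetric u) := by
  intro hcomplete
  let ν := (volume.restrict (Ioi a)).withDensity fun t => ENNReal.ofReal (Real.exp (u (t • s)))
  have : IsFiniteMeasure ν := isFiniteMeasure_withDensity hfinite
  have htail : Tendsto (fun N : ℕ => ν (Ici N)) atTop (𝓝 0) := by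
    have hempty : ⋂ N : ℕ, Ici (N : ℝ) = ∅ := by
      rw [← not_nonempty_iff_eq_empty, nonempty_iInter_Ici_iff, not_bddAbove_iff]
      simpa using exists_nat_gt
    have hlim := tendsto_measure_iInter_atTop (μ := ν) (s := fun N : ℕ => Ici (N : ℝ))
      (fun N => measurableSet_Ici.nullMeasurableSet)
      (fun M N hMN => Ici_subset_Ici.2 (Nat.cast_le.2 hMN)) ⟨0, measure_ne_top _ _⟩
    rwa [hempty, measure_empty] at hlim
  have hdist {N k m : ℕ} (hN : a < N) (hNk : N ≤ k) (hkm : k ≤ m) :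
      riemannianDist (conformalMetric u) ((k : ℝ) • s) ((m : ℝ) • s) ≤ ν (Ici N) := by
    have hIci : Ici (N : ℝ) ⊆ Ioi a := Ici_subset_Ioi.2 hN
    rw [withDensity_apply _ measurableSet_Ici, Measure.restrict_restrict measurableSet_Ici,
      inter_eq_left.2 hIci]
    exact (riemannianDist_smul_smul_le u hs (Nat.cast_le.2 hkm)).trans
      (lintegral_mono_set fun t ht => (Nat.cast_le.2 hNk).trans ht.1)
  obtain ⟨x, hx⟩ := hcomplete (fun k : ℕ => (k : ℝ) • s) fun ε hε => by
    obtain ⟨N, hNε, hNa⟩ := ((htail.eventually_lt_const hε).and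
      (tendsto_natCast_atTop_atTop.eventually_gt_atTop a)).exists
    refine ⟨N, fun k hk m hm => ?_⟩
    obtain hkm | hmk := le_total k m
    · exact (hdist hNa hk hkm).trans_lt hNε
    · rw [riemannianDist_conformalMetric_comm]
      exact (hdist hNa hm hmk).trans_lt hNε
  refine not_tendsto_atTop_of_tendsto_nhds (tendsto_of_tendsto_riemannianDist hu hx).norm ?_
  simpa [norm_smul, hs] using tendsto_natCast_atTop_atTop (R := ℝ)

end CompleteMetric

/-! ### Mean values of functions superharmonic near infinity -/

section Superharmonic

variable {E : Type*} [NormedAddCommGroup E] [InnerProductSpace ℝ E] [FiniteDimensional ℝ E]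
  {u w : E → ℝ}

theorem laplacian_exp_const_mul (hu : ContDiff ℝ 2 u) (a : ℝ) (x : E) :
    Laplacian.laplacian (fun y => Real.exp (a * u y)) x =
      a * Real.exp (a * u x) * (Laplacian.laplacian u x + a * ‖fderiv ℝ u x‖ ^ 2) := by
  have hderiv (y : E) : HasFDerivAt (fun z => Real.exp (a * u z))
      ((a * Real.exp (a * u y)) • fderiv ℝ u y) y := by
    refine (((hu.differentiable two_ne_zero y).hasFDerivAt.const_mul a).exp).congr_fderiv ?_
    rw [smul_smul, mul_comm]
  have hderiv₂ : HasFDerivAt (fderiv ℝ fun z => Real.exp (a * u z))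
      ((a * Real.exp (a * u x)) • fderiv ℝ (fderiv ℝ u) x +
        (a • (a * Real.exp (a * u x)) • fderiv ℝ u x).smulRight (fderiv ℝ u x)) x := by
    rw [funext fun y => (hderiv y).fderiv]
    exact ((hderiv x).const_mul a).smul
      ((hu.fderiv_right (m := 1) le_rfl).differentiable one_ne_zero x).hasFDerivAt
  let b := stdOrthonormalBasis ℝ E
  rw [laplacian_eq_sum_fderiv_fderiv b, laplacian_eq_sum_fderiv_fderiv b, hderiv₂.fderiv,
    b.norm_dual, Finset.mul_sum, ← Finset.sum_add_distrib, Finset.mul_sum]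
  refine Finset.sum_congr rfl fun i _ => ?_
  simp only [add_apply, smul_apply, ContinuousLinearMap.smulRight_apply, smul_eq_mul]
  ring

variable [MeasurableSpace E] [BorelSpace E]

theorem pow_mul_deriv_sphericalMean_le (hn : 2 ≤ Module.finrank ℝ E) (hw : ContDiff ℝ 2 w)
    {g : E → ℝ} (hg : Continuous g) (hg_int : Integrable g) (hg_nonneg : ∀ x, 0 ≤ g x)
    (hle : ∀ x, Laplacian.laplacian w x ≤ g x) (c : E) {r : ℝ} (hr : 0 ≤ r) :
    r ^ (Module.finrank ℝ E - 1) * deriv (sphericalMean w c) r ≤ (∫ x, g x) / sphereArea E := by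
  have : Nontrivial E := Module.nontrivial_of_finrank_pos (R := ℝ) (by omega)
  have hlaplacian := (contDiff_laplacian (k := 0) hw).continuous
  have hmean := continuous_sphericalMean hlaplacian c
  have hmean' := continuous_sphericalMean hg c
  have hpolar := integrableOn_pow_smul_sphericalMean hg_int c
  rw [integral_eq_integral_sphericalMean hg_int c, smul_eq_mul,
    mul_div_cancel_left₀ _ (sphereArea_pos E).ne']
  simp only [smul_eq_mul] at hpolar ⊢
  rw [pow_mul_deriv_sphericalMean hn hw]
  calc ∫ t in (0)..r, t ^ (Module.finrank ℝ E - 1) * sphericalMean (Laplacian.laplacian w) c t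
      ≤ ∫ t in (0)..r, t ^ (Module.finrank ℝ E - 1) * sphericalMean g c t := by
        refine intervalIntegral.integral_mono_on hr
          (Continuous.intervalIntegrable (by fun_prop) _ _)
          (Continuous.intervalIntegrable (by fun_prop) _ _) fun t ht => ?_
        exact mul_le_mul_of_nonneg_left (sphericalMean_mono hlaplacian hg fun s _ => hle _)
          (pow_nonneg ht.1 _)
    _ ≤ ∫ t in Ioi 0, t ^ (Module.finrank ℝ E - 1) * sphericalMean g c t := by
        rw [intervalIntegral.integral_of_le hr]
        refine setIntegral_mono_set hpolar ?_ Ioc_subset_Ioi_self.eventuallyLE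
        filter_upwards [ae_restrict_mem measurableSet_Ioi] with t ht
        exact mul_nonneg (pow_nonneg ht.out.le _) (integral_nonneg fun s => hg_nonneg _)

theorem exists_sphericalMean_le_of_laplacian_nonpos (hn : 2 < Module.finrank ℝ E)
    (hw : ContDiff ℝ 2 w) {R : ℝ} (hsuper : ∀ x, R ≤ ‖x‖ → Laplacian.laplacian w x ≤ 0) :
    ∃ C ≥ 0, ∀ c : E, R < ‖c‖ → ∀ r ≥ 0,
      sphericalMean w c r ≤ w c + C * ((‖c‖ - R) ^ (Module.finrank ℝ E - 2))⁻¹ := by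
  have : Nontrivial E := Module.nontrivial_of_finrank_pos (R := ℝ) (by omega)
  have hn' : (0 : ℝ) < Module.finrank ℝ E - 2 := sub_pos.2 (by exact_mod_cast hn)
  have hlaplacian := (contDiff_laplacian (k := 0) hw).continuous
  let g : E → ℝ := fun x => max (Laplacian.laplacian w x) 0
  have hg : Continuous g := by fun_prop
  have hg_int : Integrable g := by
    refine hg.integrable_of_hasCompactSupport
      (.intro (isCompact_closedBall 0 R) fun x hx => max_eq_right (hsuper x ?_))
    rw [mem_closedBall_zero_iff, not_le] at hx
    exact hx.le
  have hg_nonneg (x : E) : 0 ≤ g x := le_max_right _ _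
  have hA : 0 ≤ (∫ x, g x) / sphereArea E :=
    div_nonneg (integral_nonneg hg_nonneg) (sphereArea_pos E).le
  refine ⟨(∫ x, g x) / sphereArea E / (Module.finrank ℝ E - 2), by positivity,
    fun c hc r hr => ?_⟩
  have hle := (hasRadialLaplacian_sphericalMean hn.le hw c).le_add_of_pow_mul_deriv_le hn
    (sub_pos.2 hc) hA (fun t ht => ?_)
    (fun t ht => pow_mul_deriv_sphericalMean_le hn.le hw hg hg_int hg_nonneg
      (fun x => le_max_left _ _) c ((sub_pos.2 hc).le.trans ht)) hr
  · rwa [sphericalMean_zero_right] at hle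
  · refine integral_nonpos fun s => hsuper _ ?_
    have hs : ‖t • (s : E)‖ = t := by simp [norm_smul, abs_of_pos ht.1]
    linarith [norm_sub_le_norm_add c (t • (s : E)), ht.2]

theorem setIntegral_ball_le_of_sphericalMean_le [Nontrivial E] (hw : Continuous w) {c : E}
    {R B : ℝ} (hB : ∀ r ∈ Ioo 0 R, sphericalMean w c r ≤ B) :
    ∫ x in Metric.ball c R, w x ≤ volume.real (Metric.ball c R) * B := by
  have hint : IntegrableOn w (Metric.ball c R) :=
    (hw.continuousOn.integrableOn_compact (isCompact_closedBall c R)).mono_set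
      Metric.ball_subset_closedBall
  have hint_const : IntegrableOn (fun _ => B) (Metric.ball c R) :=
    integrableOn_const measure_ball_lt_top.ne
  let f : E → ℝ := (Metric.ball c R).indicator fun x => w x - B
  have hmean (r : ℝ) (hr : 0 < r) : sphericalMean f c r ≤ 0 := by
    have hmem (s : Metric.sphere (0 : E) 1) : c + r • (s : E) ∈ Metric.ball c R ↔ r < R := by
      simp [norm_smul, abs_of_pos hr]
    by_cases hrR : r < R
    · simp only [sphericalMean, f, indicator_of_mem ((hmem _).2 hrR)]
      rw [integral_sub (integrable_uniformSphere (by fun_prop)) (integrable_const B)]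
      simpa [sphericalMean] using hB r ⟨hr, hrR⟩
    · simp [sphericalMean, f, indicator_of_notMem (mt (hmem _).1 hrR)]
  have hnonpos : ∫ x, f x ≤ 0 := by
    have hf : Integrable f :=
      IntegrableOn.integrable_indicator (hint.sub hint_const) measurableSet_ball
    rw [integral_eq_integral_sphericalMean hf c]
    exact mul_nonpos_of_nonneg_of_nonpos (sphereArea_pos E).le <|
      setIntegral_nonpos measurableSet_Ioi fun r hr =>
        mul_nonpos_of_nonneg_of_nonpos (pow_nonneg hr.out.le _) (hmean r hr)
  simp only [f] at hnonpos
  rw [integral_indicator measurableSet_ball, integral_sub hint hint_const] at hnonpos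
  simpa using hnonpos

theorem exists_mem_sphere_le_sphericalMean [Nontrivial E] (hw : Continuous w) (c : E) {r : ℝ}
    (hr : 0 ≤ r) : ∃ x ∈ Metric.sphere c r, w x ≤ sphericalMean w c r := by
  obtain ⟨s, hs⟩ := exists_le_integral (μ := uniformSphere E)
    (f := fun s : Metric.sphere (0 : E) 1 => w (c + r • (s : E)))
    (integrable_uniformSphere (by fun_prop))
  exact ⟨c + r • (s : E), by simp [norm_smul, abs_of_nonneg hr], hs⟩

end Superharmonic

/-! ### Growth of the conformal factor -/

section Growth

theorem le_add_rpow_mul_rpow {a b q : ℝ} (ha : 0 ≤ a) (hb : 0 < b) (hq : 1 ≤ q) :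
    a ≤ b + b ^ (1 - q) * a ^ q := by
  rcases le_total a b with hab | hba
  · have : 0 ≤ b ^ (1 - q) * a ^ q := by positivity
    linarith
  · have ha' : 0 < a := hb.trans_le hba
    calc a = a ^ (1 - q) * a ^ q := by rw [← Real.rpow_add ha', sub_add_cancel, Real.rpow_one]
      _ ≤ b ^ (1 - q) * a ^ q := mul_le_mul_of_nonneg_right
        (Real.rpow_le_rpow_of_nonpos hb hba (sub_nonpos.2 hq)) (by positivity)
      _ ≤ b + b ^ (1 - q) * a ^ q := le_add_of_nonneg_left hb.le

variable {E : Type*} [NormedAddCommGroup E]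

theorem setLIntegral_Ici_norm_lt_top_of_annulus_le [MeasurableSpace E] {μ : Measure E}
    {f : E → ℝ≥0∞} {R C ε : ℝ} (hR : 0 < R) (hε : 0 < ε)
    (h : ∀ r ≥ R, ∫⁻ x in norm ⁻¹' Ico r (2 * r), f x ∂μ ≤ ENNReal.ofReal (C * r ^ (-ε))) :
    ∫⁻ x in norm ⁻¹' Ici R, f x ∂μ < ⊤ := by
  have hcover : norm ⁻¹' Ici R ⊆
      ⋃ k : ℕ, (norm ⁻¹' Ico (2 ^ k * R) (2 * (2 ^ k * R)) : Set E) := fun x hx => by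
    obtain ⟨k, hk, hk'⟩ := exists_nat_pow_near ((one_le_div hR).2 hx) one_lt_two
    rw [le_div_iff₀ hR] at hk
    rw [div_lt_iff₀ hR, pow_succ'] at hk'
    exact mem_iUnion.2 ⟨k, hk, by linarith⟩
  have hsummable : Summable fun k : ℕ => C * ((2 : ℝ) ^ k * R) ^ (-ε) := by
    simp_rw [Real.mul_rpow (pow_nonneg zero_le_two _) hR.le, ← Real.rpow_natCast_mul zero_le_two,
      mul_comm (_ : ℝ) (-ε), Real.rpow_mul_natCast zero_le_two]
    exact ((summable_geometric_of_lt_one (by positivity)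
      (Real.rpow_lt_one_of_one_lt_of_neg one_lt_two (neg_neg_of_pos hε))).mul_right _).mul_left C
  calc ∫⁻ x in norm ⁻¹' Ici R, f x ∂μ
      ≤ ∑' k : ℕ, ∫⁻ x in norm ⁻¹' Ico (2 ^ k * R) (2 * (2 ^ k * R)), f x ∂μ :=
        (lintegral_mono_set hcover).trans (lintegral_iUnion_le _ f)
    _ ≤ ∑' k : ℕ, ENNReal.ofReal (C * (2 ^ k * R) ^ (-ε)) :=
        ENNReal.tsum_le_tsum fun k => h _ (le_mul_of_one_le_left hR.le (one_le_pow₀ one_le_two))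
    _ < ⊤ := hsummable.tsum_ofReal_lt_top

theorem exists_lintegral_ray_ne_top [NormedSpace ℝ E] [FiniteDimensional ℝ E] [Nontrivial E]
    [MeasurableSpace E] [BorelSpace E] {μ : Measure E} [μ.IsAddHaarMeasure] {f : E → ℝ≥0∞}
    (hf : Measurable f) {R : ℝ} (hR : 0 < R)
    (hfinite : ∫⁻ x in norm ⁻¹' Ici R,
      ENNReal.ofReal (‖x‖ ^ (Module.finrank ℝ E - 1))⁻¹ * f x ∂μ ≠ ⊤) :
    ∃ s : E, ‖s‖ = 1 ∧ ∫⁻ t in Ioi R, f (t • s) ≠ ⊤ := by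
  have hset : MeasurableSet (norm ⁻¹' Ici R : Set E) := measurable_norm measurableSet_Ici
  rw [← lintegral_indicator hset, lintegral_eq_lintegral_toSphere μ
    (Measurable.indicator (by fun_prop) hset)] at hfinite
  have hray (s : Metric.sphere (0 : E) 1) : ∫⁻ t in Ioi R, f (t • (s : E)) ≤
      ∫⁻ r in Ioi 0, ENNReal.ofReal (r ^ (Module.finrank ℝ E - 1)) *
        (norm ⁻¹' Ici R).indicator (fun x => ENNReal.ofReal
          (‖x‖ ^ (Module.finrank ℝ E - 1))⁻¹ * f x) (r • (s : E)) := by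
    refine (setLIntegral_congr_fun measurableSet_Ioi fun r hr => ?_).trans_le
      (lintegral_mono_set (Ioi_subset_Ioi hR.le))
    have hr0 : 0 < r := hR.trans hr
    have hnorm : ‖r • (s : E)‖ = r := by simp [norm_smul, abs_of_pos hr0]
    rw [indicator_of_mem (by simpa [hnorm] using hr.out.le), hnorm, ← mul_assoc,
      ← ENNReal.ofReal_mul (by positivity), mul_inv_cancel₀ (by positivity), ENNReal.ofReal_one,
      one_mul]
  by_contra! htop
  refine hfinite (top_unique ?_)
  calc (⊤ : ℝ≥0∞) = ∫⁻ _ : Metric.sphere (0 : E) 1, ⊤ ∂μ.toSphere := by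
        rw [lintegral_const,
          ENNReal.top_mul (Measure.measure_univ_ne_zero.2 (Measure.toSphere_ne_zero μ))]
    _ ≤ _ := lintegral_mono fun s => (htop s (by simp)).ge.trans (hray s)

variable [InnerProductSpace ℝ E] [FiniteDimensional ℝ E] [MeasurableSpace E] [BorelSpace E]
  {u : E → ℝ} (hu : ContDiff ℝ 2 u) {R : ℝ} (hR : 0 < R) (hsuper : ∀ x, R ≤ ‖x‖ →
    Laplacian.laplacian u x ≤ -(((Module.finrank ℝ E : ℝ) - 2) / 2 * ‖fderiv ℝ u x‖ ^ 2))
include hu hR hsuper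

theorem exists_sphericalMean_exp_mul_le (hn : 2 < Module.finrank ℝ E) :
    ∃ C ≥ 0, ∀ c, 2 * R ≤ ‖c‖ → ∀ r ≥ 0,
      sphericalMean (fun x => Real.exp (((Module.finrank ℝ E : ℝ) - 2) / 2 * u x)) c r ≤
        C * max (Real.exp (u c)) (‖c‖ ^ (-2 : ℝ)) ^ (((Module.finrank ℝ E : ℝ) - 2) / 2) := by
  set q : ℝ := ((Module.finrank ℝ E : ℝ) - 2) / 2 with hq_def
  have hq : 0 < q := half_pos (sub_pos.2 (by exact_mod_cast hn))
  obtain ⟨C, hC, hmean⟩ := exists_sphericalMean_le_of_laplacian_nonpos hn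
    (w := fun x => Real.exp (q * u x)) (by fun_prop) (R := R) fun x hx => by
      rw [laplacian_exp_const_mul hu]
      exact mul_nonpos_of_nonneg_of_nonpos (by positivity) (by linarith [hsuper x hx])
  refine ⟨1 + C * 2 ^ (Module.finrank ℝ E - 2), by positivity, fun c hc r hr => ?_⟩
  have hc0 : 0 < ‖c‖ := by linarith
  set M := max (Real.exp (u c)) (‖c‖ ^ (-2 : ℝ))
  have hexp : Real.exp (q * u c) ≤ M ^ q := by
    rw [mul_comm, Real.exp_mul]
    exact Real.rpow_le_rpow (Real.exp_pos _).le (le_max_left _ _) hq.le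
  have hpow : (‖c‖ ^ (Module.finrank ℝ E - 2))⁻¹ ≤ M ^ q := by
    have hexponent : -2 * q = -((Module.finrank ℝ E - 2 : ℕ) : ℝ) := by
      rw [Nat.cast_sub hn.le, hq_def]
      push_cast
      ring
    rw [← Real.rpow_natCast, ← Real.rpow_neg hc0.le, ← hexponent, Real.rpow_mul hc0.le]
    exact Real.rpow_le_rpow (by positivity) (le_max_right _ _) hq.le
  calc sphericalMean (fun x => Real.exp (q * u x)) c r
      ≤ Real.exp (q * u c) + C * ((‖c‖ - R) ^ (Module.finrank ℝ E - 2))⁻¹ :=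
        hmean c (by linarith) r hr
    _ ≤ Real.exp (q * u c) + C * ((‖c‖ / 2) ^ (Module.finrank ℝ E - 2))⁻¹ := by
        gcongr
        linarith
    _ = Real.exp (q * u c) +
          C * 2 ^ (Module.finrank ℝ E - 2) * (‖c‖ ^ (Module.finrank ℝ E - 2))⁻¹ := by
        rw [div_pow, inv_div]
        ring
    _ ≤ M ^ q + C * 2 ^ (Module.finrank ℝ E - 2) * M ^ q := by gcongr
    _ = (1 + C * 2 ^ (Module.finrank ℝ E - 2)) * M ^ q := by ring

theorem exists_sphericalMean_exp_le (hn : 4 ≤ Module.finrank ℝ E) :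
    ∃ C ≥ 0, ∀ c, 2 * R ≤ ‖c‖ → ∀ r ≥ 0,
      sphericalMean (fun x => Real.exp (u x)) c r ≤
        C * max (Real.exp (u c)) (‖c‖ ^ (-2 : ℝ)) := by
  have : Nontrivial E := Module.nontrivial_of_finrank_pos (R := ℝ) (by omega)
  obtain ⟨C, hC, hmean⟩ := exists_sphericalMean_exp_mul_le hu hR hsuper (by omega)
  set q : ℝ := ((Module.finrank ℝ E : ℝ) - 2) / 2
  have hq : 1 ≤ q := by
    have : (4 : ℝ) ≤ Module.finrank ℝ E := by exact_mod_cast hn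
    simp only [q]
    linarith
  refine ⟨1 + C, by positivity, fun c hc r hr => ?_⟩
  set M := max (Real.exp (u c)) (‖c‖ ^ (-2 : ℝ))
  have hM : 0 < M := lt_max_of_lt_left (Real.exp_pos _)
  have hcontinuous := hu.continuous
  calc sphericalMean (fun x => Real.exp (u x)) c r
      ≤ sphericalMean (fun x => M + M ^ (1 - q) * Real.exp (q * u x)) c r := by
        refine sphericalMean_mono (by fun_prop) (by fun_prop) fun s _ => ?_
        rw [mul_comm q, Real.exp_mul]
        exact le_add_rpow_mul_rpow (Real.exp_pos _).le hM hq
    _ = M + M ^ (1 - q) * sphericalMean (fun x => Real.exp (q * u x)) c r := by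
        simp only [sphericalMean]
        rw [integral_add (integrable_const M) (integrable_uniformSphere (by fun_prop)),
          integral_const_mul]
        simp
    _ ≤ M + M ^ (1 - q) * (C * M ^ q) := by
        gcongr
        exact hmean c hc r hr
    _ = M + C * (M ^ (1 - q) * M ^ q) := by ring
    _ = (1 + C) * M := by
        rw [← Real.rpow_add hM, sub_add_cancel, Real.rpow_one]
        ring

theorem exists_setIntegral_ball_exp_le (hn : 4 ≤ Module.finrank ℝ E) :
    ∃ C ≥ 0, ∀ r ≥ 2 * R, ∫ x in Metric.ball 0 (2 * r), Real.exp (u x) ≤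
      C * r ^ Module.finrank ℝ E * max (Real.exp (sphericalMean u 0 r)) (r ^ (-2 : ℝ)) := by
  have : Nontrivial E := Module.nontrivial_of_finrank_pos (R := ℝ) (by omega)
  have hcontinuous := hu.continuous
  obtain ⟨C, hC, hmean⟩ := exists_sphericalMean_exp_le hu hR hsuper hn
  refine ⟨volume.real (Metric.ball (0 : E) 1) * 3 ^ Module.finrank ℝ E * C, by positivity,
    fun r hr => ?_⟩
  have hr0 : 0 < r := by linarith
  obtain ⟨c, hc, hle⟩ := exists_mem_sphere_le_sphericalMean hcontinuous (0 : E) hr0.le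
  rw [mem_sphere_zero_iff_norm] at hc
  have hsubset : Metric.ball (0 : E) (2 * r) ⊆ Metric.ball c (3 * r) :=
    Metric.ball_subset_ball' (by rw [dist_zero_left, hc]; linarith)
  calc ∫ x in Metric.ball 0 (2 * r), Real.exp (u x)
      ≤ ∫ x in Metric.ball c (3 * r), Real.exp (u x) := by
        refine setIntegral_mono_set ?_ (.of_forall fun x => (Real.exp_pos _).le)
          hsubset.eventuallyLE
        exact ((Real.continuous_exp.comp hcontinuous).continuousOn.integrableOn_compact
          (isCompact_closedBall c (3 * r))).mono_set Metric.ball_subset_closedBall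
    _ ≤ volume.real (Metric.ball c (3 * r)) * (C * max (Real.exp (u c)) (‖c‖ ^ (-2 : ℝ))) :=
        setIntegral_ball_le_of_sphericalMean_le (by fun_prop) fun t ht =>
          hmean c (hr.trans_eq hc.symm) t ht.1.le
    _ ≤ volume.real (Metric.ball c (3 * r)) *
          (C * max (Real.exp (sphericalMean u 0 r)) (r ^ (-2 : ℝ))) := by
        rw [hc]
        gcongr
    _ = _ := by
        rw [measureReal_def, measureReal_def, volume.addHaar_ball c (by positivity),
          ENNReal.toReal_mul, ENNReal.toReal_ofReal (by positivity), mul_pow]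
        ring

theorem exists_lintegral_annulus_exp_le (hn : 4 ≤ Module.finrank ℝ E) :
    ∃ C ≥ 0, ∀ r ≥ 2 * R, ∫⁻ x in norm ⁻¹' Ico r (2 * r),
        ENNReal.ofReal (‖x‖ ^ (Module.finrank ℝ E - 1))⁻¹ * ENNReal.ofReal (Real.exp (u x)) ≤
      ENNReal.ofReal (C * r * max (Real.exp (sphericalMean u 0 r)) (r ^ (-2 : ℝ))) := by
  have hcontinuous := hu.continuous
  obtain ⟨C, hC, hball⟩ := exists_setIntegral_ball_exp_le hu hR hsuper hn
  refine ⟨C, hC, fun r hr => ?_⟩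
  have hr0 : 0 < r := by linarith
  have hset : MeasurableSet (norm ⁻¹' Ico r (2 * r) : Set E) := measurable_norm measurableSet_Ico
  have hint : IntegrableOn (fun x => Real.exp (u x)) (Metric.ball 0 (2 * r)) :=
    ((Real.continuous_exp.comp hcontinuous).continuousOn.integrableOn_compact
      (isCompact_closedBall 0 (2 * r))).mono_set Metric.ball_subset_closedBall
  calc ∫⁻ x in norm ⁻¹' Ico r (2 * r),
        ENNReal.ofReal (‖x‖ ^ (Module.finrank ℝ E - 1))⁻¹ * ENNReal.ofReal (Real.exp (u x))
      ≤ ∫⁻ x in norm ⁻¹' Ico r (2 * r),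
        ENNReal.ofReal (r ^ (Module.finrank ℝ E - 1))⁻¹ * ENNReal.ofReal (Real.exp (u x)) := by
        refine setLIntegral_mono' hset fun x hx => ?_
        gcongr
        exact hx.1
    _ ≤ ∫⁻ x in Metric.ball 0 (2 * r),
        ENNReal.ofReal (r ^ (Module.finrank ℝ E - 1))⁻¹ * ENNReal.ofReal (Real.exp (u x)) :=
        lintegral_mono_set fun x hx => mem_ball_zero_iff.2 hx.2
    _ = ENNReal.ofReal ((r ^ (Module.finrank ℝ E - 1))⁻¹ *
          ∫ x in Metric.ball 0 (2 * r), Real.exp (u x)) := by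
        rw [lintegral_const_mul _ (by fun_prop), ENNReal.ofReal_mul (by positivity),
          ofReal_integral_eq_lintegral_ofReal hint (.of_forall fun x => (Real.exp_pos _).le)]
    _ ≤ _ := by
        refine ENNReal.ofReal_le_ofReal ((mul_le_mul_of_nonneg_left (hball r hr)
          (by positivity)).trans_eq ?_)
        rw [show r ^ Module.finrank ℝ E = r ^ (Module.finrank ℝ E - 1) * r by
          rw [← pow_succ, Nat.sub_add_cancel (by omega)]]
        field_simp

end Growth

section Ray

variable {E : Type*} [NormedAddCommGroup E]

theorem exists_pos_forall_of_eventually_cocompact [ProperSpace E] {P : E → Prop}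
    (h : ∀ᶠ x in cocompact E, P x) : ∃ R > 0, ∀ x, R ≤ ‖x‖ → P x := by
  rw [← Metric.cobounded_eq_cocompact] at h
  obtain ⟨R, -, hR⟩ := hasBasis_cobounded_norm.eventually_iff.1 h
  exact ⟨max R 1, by positivity, fun x hx => hR (le_of_max_le_left hx)⟩

variable [InnerProductSpace ℝ E] [FiniteDimensional ℝ E] [MeasurableSpace E] [BorelSpace E]
  {u : E → ℝ}

theorem exists_lintegral_ray_exp_ne_top (hn : 4 ≤ Module.finrank ℝ E) (hu : ContDiff ℝ 2 u)
    (hsuper : ∀ᶠ x in cocompact E,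
      Laplacian.laplacian u x ≤ -(((Module.finrank ℝ E : ℝ) - 2) / 2 * ‖fderiv ℝ u x‖ ^ 2))
    {β : ℝ} (hβ : 1 < β) (hdecay : ∀ᶠ r in atTop, Real.exp (sphericalMean u 0 r) ≤ r ^ (-β)) :
    ∃ (s : E) (a : ℝ), ‖s‖ = 1 ∧ ∫⁻ t in Ioi a, ENNReal.ofReal (Real.exp (u (t • s))) ≠ ⊤ := by
  have : Nontrivial E := Module.nontrivial_of_finrank_pos (R := ℝ) (by omega)
  have hcontinuous := hu.continuous
  obtain ⟨R, hR, hsuper⟩ := exists_pos_forall_of_eventually_cocompact hsuper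
  obtain ⟨C, hC, hannulus⟩ := exists_lintegral_annulus_exp_le hu hR hsuper hn
  obtain ⟨S, hS⟩ := eventually_atTop.1 <|
    hdecay.and ((eventually_ge_atTop 1).and (eventually_ge_atTop (2 * R)))
  have hS1 : 1 ≤ S := (hS S le_rfl).2.1
  have hfinite := setLIntegral_Ici_norm_lt_top_of_annulus_le (μ := (volume : Measure E)) (C := C)
    (f := fun x => ENNReal.ofReal (‖x‖ ^ (Module.finrank ℝ E - 1))⁻¹ *
      ENNReal.ofReal (Real.exp (u x)))
    (zero_lt_one.trans_le hS1) (sub_pos.2 (lt_min hβ one_lt_two)) fun r hr => by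
      obtain ⟨hdecay, hr1, hrR⟩ := hS r hr
      have hr0 : 0 < r := zero_lt_one.trans_le hr1
      refine (hannulus r hrR).trans (ENNReal.ofReal_le_ofReal ?_)
      calc C * r * max (Real.exp (sphericalMean u 0 r)) (r ^ (-2 : ℝ))
          ≤ C * r * r ^ (-min β 2) := by
            gcongr
            refine max_le (hdecay.trans ?_) ?_
            exacts [Real.rpow_le_rpow_of_exponent_le hr1 (neg_le_neg (min_le_left _ _)),
              Real.rpow_le_rpow_of_exponent_le hr1 (neg_le_neg (min_le_right _ _))]
        _ = C * r ^ (-(min β 2 - 1)) := by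
            rw [neg_sub, sub_eq_add_neg, Real.rpow_add hr0, Real.rpow_one, mul_assoc]
  obtain ⟨s, hs, hray⟩ := exists_lintegral_ray_ne_top (by fun_prop) (zero_lt_one.trans_le hS1)
    hfinite.ne
  exact ⟨s, S, hs, hray⟩

end Ray

/-! ### Bounds for the total Q-curvature -/

section TotalCurvature

variable {n : ℕ} {u : EuclideanSpace ℝ (Fin n) → ℝ}

theorem eventually_sphericalMean_laplacian_le (hn : 2 ≤ n) (hu : ContDiff ℝ 2 u) {b : ℝ → ℝ}
    (hb : ∀ᶠ r in atTop, 0 ≤ b r)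
    (hcurv : ∀ᶠ x in cocompact (EuclideanSpace ℝ (Fin n)),
      b ‖x‖ ≤ scalarCurvature (conformalMetric u) x) :
    ∀ᶠ r in atTop, sphericalMean (Laplacian.laplacian u) 0 r ≤
      -((n - 2) / 2 * deriv (sphericalMean u 0) r ^ 2)
        - b r / (2 * (n - 1)) * Real.exp (2 * sphericalMean u 0 r) := by
  obtain ⟨R, hR, hcurv⟩ := exists_pos_forall_of_eventually_cocompact hcurv
  filter_upwards [hb, eventually_ge_atTop R] with r hr hRr
  exact sphericalMean_laplacian_le hn hu (hR.le.trans hRr) hr fun x hx => by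
    simpa only [hx] using hcurv x (hRr.trans_eq hx.symm)

section NonnegativeScalarCurvature

variable (hn : 4 ≤ n) (hn_even : Even n) (hu : ContDiff ℝ n u)
  (hfinite : Integrable fun x => qCurvature u x * Real.exp (n * u x))
  (hcurv : ∀ᶠ x in cocompact (EuclideanSpace ℝ (Fin n)),
    0 ≤ scalarCurvature (conformalMetric u) x)
include hn hn_even hu hfinite hcurv

theorem tendsto_mul_deriv_sphericalMean_of_scalarCurvature_nonneg :
    Tendsto (fun r => r * deriv (sphericalMean u 0) r) atTop (𝓝 (-normalizedTotalQ u)) := by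
  have hu₂ : ContDiff ℝ 2 u := hu.of_le (by exact_mod_cast (show 2 ≤ n by omega))
  have hv := hasRadialLaplacian_sphericalMean (by simp; omega) hu₂ 0
  refine tendsto_mul_deriv_sphericalMean (by omega) hn_even hu hfinite
    (hv.isBigO_mul_deriv (by simp; omega) ?_)
  simpa using eventually_sphericalMean_laplacian_le (by omega) hu₂ (b := 0) (by simp) hcurv

theorem normalizedTotalQ_nonneg : 0 ≤ normalizedTotalQ u := by
  have hu₂ : ContDiff ℝ 2 u := hu.of_le (by exact_mod_cast (show 2 ≤ n by omega))
  have hn' : (2 : ℝ) ≤ n := by exact_mod_cast (show 2 ≤ n by omega)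
  refine (hasRadialLaplacian_sphericalMean (by simp; omega) hu₂ 0).nonneg_of_tendsto_mul_deriv
    (tendsto_mul_deriv_sphericalMean_of_scalarCurvature_nonneg hn hn_even hu hfinite hcurv)
    (by simp; omega) ?_
  filter_upwards [eventually_sphericalMean_laplacian_le (by omega) hu₂ (b := 0) (by simp) hcurv]
    with r hr
  have : 0 ≤ ((n : ℝ) - 2) / 2 * deriv (sphericalMean u 0) r ^ 2 :=
    mul_nonneg (by linarith) (sq_nonneg _)
  simp only [Pi.zero_apply, zero_div, zero_mul, sub_zero] at hr
  linarith

theorem normalizedTotalQ_le_one (hcomplete : IsCompleteMetric (conformalMetric u)) :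
    normalizedTotalQ u ≤ 1 := by
  by_contra! hlt
  obtain ⟨β, hβ, hβQ⟩ := exists_between hlt
  have hu₂ : ContDiff ℝ 2 u := hu.of_le (by exact_mod_cast (show 2 ≤ n by omega))
  have hv := hasRadialLaplacian_sphericalMean (by simp; omega) hu₂ 0
  have hsuper : ∀ᶠ x in cocompact (EuclideanSpace ℝ (Fin n)), Laplacian.laplacian u x ≤
      -(((Module.finrank ℝ (EuclideanSpace ℝ (Fin n)) : ℝ) - 2) / 2 * ‖fderiv ℝ u x‖ ^ 2) := by
    filter_upwards [hcurv] with x hx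
    simpa using laplacian_le_of_le_scalarCurvature (by omega) hu₂ hx
  obtain ⟨s, a, hs, hray⟩ := exists_lintegral_ray_exp_ne_top (by simpa using hn) hu₂ hsuper hβ <|
    eventually_exp_le_rpow hv.differentiable
      (tendsto_mul_deriv_sphericalMean_of_scalarCurvature_nonneg hn hn_even hu hfinite hcurv)
      (neg_lt_neg hβQ)
  exact not_isCompleteMetric_of_lintegral_ray_ne_top hu₂.continuous hs hray hcomplete

end NonnegativeScalarCurvature

theorem one_sub_half_le_normalizedTotalQ (hn : 4 ≤ n) (hn_even : Even n) (hu : ContDiff ℝ n u)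
    (hfinite : Integrable fun x => qCurvature u x * Real.exp (n * u x)) {C p : ℝ} (hC : 0 < C)
    (hcurv : ∀ᶠ x in cocompact (EuclideanSpace ℝ (Fin n)),
      C * ‖x‖ ^ (-p) ≤ scalarCurvature (conformalMetric u) x) :
    1 - p / 2 ≤ normalizedTotalQ u := by
  have hu₂ : ContDiff ℝ 2 u := hu.of_le (by exact_mod_cast (show 2 ≤ n by omega))
  have hn' : (2 : ℝ) ≤ n := by exact_mod_cast (show 2 ≤ n by omega)
  have hlim := tendsto_mul_deriv_sphericalMean_of_scalarCurvature_nonneg hn hn_even hu hfinite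
    (hcurv.mono fun x hx => le_trans (by positivity) hx)
  have hradial := eventually_sphericalMean_laplacian_le (by omega) hu₂ (b := fun r => C * r ^ (-p))
    ((eventually_ge_atTop 0).mono fun r hr => by positivity) hcurv
  refine (hasRadialLaplacian_sphericalMean (by simp; omega) hu₂
    0).one_sub_half_le_of_tendsto_mul_deriv hlim (by simp; omega)
    (c := C / (2 * (n - 1))) (div_pos hC (by linarith)) ?_
  filter_upwards [hradial] with r hr
  have : 0 ≤ ((n : ℝ) - 2) / 2 * deriv (sphericalMean u 0) r ^ 2 :=
    mul_nonneg (by linarith) (sq_nonneg _)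
  rw [mul_div_right_comm] at hr
  linarith

theorem halfSphereTotalQ_mul_normalizedTotalQ (u : EuclideanSpace ℝ (Fin n) → ℝ) :
    halfSphereTotalQ n * normalizedTotalQ u = ∫ x, qCurvature u x * Real.exp (n * u x) :=
  mul_div_cancel₀ _ (halfSphereTotalQ_pos n).ne'

end TotalCurvature

end ConformalQ

end

open ConformalQ in
theorem mainTheorem3_general {n : ℕ} (hn : 4 ≤ n) (hn_even : Even n)
    {u : EuclideanSpace ℝ (Fin n) → ℝ} (hu : ContDiff ℝ n u)
    (hfinite : Integrable fun x => qCurvature u x * Real.exp (n * u x)) :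
    ((∀ᶠ x in cocompact (EuclideanSpace ℝ (Fin n)), 0 ≤ scalarCurvature (conformalMetric u) x) →
      0 ≤ (∫ x, qCurvature u x * Real.exp (n * u x)) ∧
      (IsCompleteMetric (conformalMetric u) →
        ∫ x, qCurvature u x * Real.exp (n * u x) ≤ halfSphereTotalQ n)) ∧
    (∀ C p : ℝ, 0 < C →
      (∀ᶠ x in cocompact (EuclideanSpace ℝ (Fin n)),
        C * ‖x‖ ^ (-p) ≤ scalarCurvature (conformalMetric u) x) →
      halfSphereTotalQ n * max 0 (1 - p / 2) ≤ (∫ x, qCurvature u x * Real.exp (n * u x)) ∧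
      (IsCompleteMetric (conformalMetric u) →
        ∫ x, qCurvature u x * Real.exp (n * u x) ≤ halfSphereTotalQ n)) ∧
    (∀ C : ℝ, 0 < C →
      (∀ᶠ x in cocompact (EuclideanSpace ℝ (Fin n)),
        C ≤ scalarCurvature (conformalMetric u) x) →
      halfSphereTotalQ n ≤ (∫ x, qCurvature u x * Real.exp (n * u x)) ∧
      (IsCompleteMetric (conformalMetric u) →
        ∫ x, qCurvature u x * Real.exp (n * u x) = halfSphereTotalQ n)) := by
  have hc : 0 ≤ halfSphereTotalQ n := (halfSphereTotalQ_pos n).le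
  simp only [← halfSphereTotalQ_mul_normalizedTotalQ]
  have hupper (hcurv) (hcomplete : IsCompleteMetric (conformalMetric u)) :
      halfSphereTotalQ n * normalizedTotalQ u ≤ halfSphereTotalQ n :=
    mul_le_of_le_one_right hc (normalizedTotalQ_le_one hn hn_even hu hfinite hcurv hcomplete)
  have hdecay (C p : ℝ) (hC : 0 < C) (hcurv : ∀ᶠ x in cocompact (EuclideanSpace ℝ (Fin n)),
      C * ‖x‖ ^ (-p) ≤ scalarCurvature (conformalMetric u) x) :
      halfSphereTotalQ n * max 0 (1 - p / 2) ≤ halfSphereTotalQ n * normalizedTotalQ u ∧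
      (IsCompleteMetric (conformalMetric u) →
        halfSphereTotalQ n * normalizedTotalQ u ≤ halfSphereTotalQ n) := by
    have hnonneg := hcurv.mono fun x hx => le_trans (by positivity) hx
    refine ⟨mul_le_mul_of_nonneg_left (max_le ?_ ?_) hc, hupper hnonneg⟩
    · exact normalizedTotalQ_nonneg hn hn_even hu hfinite hnonneg
    · exact one_sub_half_le_normalizedTotalQ hn hn_even hu hfinite hC hcurv
  refine ⟨fun hcurv => ⟨mul_nonneg hc (normalizedTotalQ_nonneg hn hn_even hu hfinite hcurv),
    hupper hcurv⟩, hdecay, fun C hC hcurv => ?_⟩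
  obtain ⟨hlower, hle⟩ := hdecay C 0 hC (by simpa using hcurv)
  simp only [zero_div, sub_zero, zero_le_one, max_eq_right, mul_one] at hlower
  exact ⟨hlower, fun hcomplete => (hle hcomplete).antisymm hlower⟩

theorem mainTheorem3 (n : ℕ) (hn : 4 ≤ n) (hn_even : Even n)
    (u : EuclideanSpace ℝ (Fin n) → ℝ) (hu : ContDiff ℝ ∞ u)
    (hcomplete : ConformalQ.IsCompleteMetric (ConformalQ.conformalMetric u))
    (hfinite : Integrable (fun x => ConformalQ.qCurvature u x * Real.exp (n * u x)) volume) :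
    -- (1) `R_g ≥ 0` near infinity
    ((∀ᶠ x in cocompact (EuclideanSpace ℝ (Fin n)),
        0 ≤ ConformalQ.scalarCurvature (ConformalQ.conformalMetric u) x) →
      0 ≤ (∫ x, ConformalQ.qCurvature u x * Real.exp (n * u x)) ∧
      (∫ x, ConformalQ.qCurvature u x * Real.exp (n * u x))
        ≤ ((n - 1).factorial : ℝ) * ConformalQ.sphereVolume n / 2) ∧
    -- (2) `R_g ≥ C |x|^{-p}` near infinity
    (∀ C p : ℝ, 0 < C → 0 ≤ p →
      (∀ᶠ x in cocompact (EuclideanSpace ℝ (Fin n)),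
        C * ‖x‖ ^ (-p) ≤ ConformalQ.scalarCurvature (ConformalQ.conformalMetric u) x) →
      ((n - 1).factorial : ℝ) * ConformalQ.sphereVolume n / 2 * max 0 (1 - p / 2)
        ≤ (∫ x, ConformalQ.qCurvature u x * Real.exp (n * u x)) ∧
      (∫ x, ConformalQ.qCurvature u x * Real.exp (n * u x))
        ≤ ((n - 1).factorial : ℝ) * ConformalQ.sphereVolume n / 2) ∧
    -- in particular, `R_g ≥ C > 0` near infinity
    (∀ C : ℝ, 0 < C →
      (∀ᶠ x in cocompact (EuclideanSpace ℝ (Fin n)),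
        C ≤ ConformalQ.scalarCurvature (ConformalQ.conformalMetric u) x) →
      (∫ x, ConformalQ.qCurvature u x * Real.exp (n * u x))
        = ((n - 1).factorial : ℝ) * ConformalQ.sphereVolume n / 2) := by
  obtain ⟨hnonneg, hdecay, hconst⟩ := mainTheorem3_general hn hn_even
    (hu.of_le (mod_cast le_top)) hfinite
  exact ⟨fun h => (hnonneg h).imp_right (· hcomplete), fun C p hC _ h =>
    (hdecay C p hC h).imp_right (· hcomplete), fun C hC h => (hconst C hC h).2 hcomplete⟩
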